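/- Let $\mathcal A$ be an abelian category and $*\in\{b,+,-,\varnothing\}$. Let $\mathscr D^*(\mathcal A)$ be the full triangulated subcategory of the derived category $\mathscr D(\mathcal A)$ formed by the complexes with bounded (for $*=b$), bounded below (for $*=+$), bounded above (for $*=-$) or arbitrary (for $*=\varnothing$) cohomology. Full subcategories are assumed closed under isomorphisms. A full subcategory $\mathcal B$ of $\mathcal A$ is an *abelian subcategory* if $\mathcal B$ is an abelian category and the inclusion $\mathcal B\to\mathcal A$ is exact; equivalently, $\mathcal B$ contains $0$ and is closed under finite direct sums, kernels and cokernels in $\mathcal A$. The inclusion then induces, by termwise application, a functor $\mathscr D^*(\mathcal B)\to\mathscr D^*(\mathcal A)$. A pair $(\mathcal X,\mathcal Y)$ of full subcategories of $\mathcal A$ is a *$\mathscr D^*$-decomposition* of $\mathcal A$ if: (D1) $\mathcal X$ and $\mathcal Y$ are abelian subcategories of $\mathcal A$, and the induced functors $\mathscr D^*(\mathcal X)\to\mathscr D^*(\mathcal A)$ and $\mathscr D^*(\mathcal Y)\to\mathscr D^*(\mathcal A)$ are fully faithful; (D2) $\mathrm{Hom}_{\mathscr D^*(\mathcal A)}(X,Y[n])=0$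 for all $X\in\mathcal X$, $Y\in\mathcal Y$ and $n\in\mathbb Z$; (D3) for every $M^\bullet\in\mathscr D^*(\mathcal A)$ there is a distinguished triangle $X_{M^\bullet}\to M^\bullet\to Y^{M^\bullet}\to X_{M^\bullet}[1]$ in $\mathscr D^*(\mathcal A)$ with $X_{M^\bullet}$ in the image of $\mathscr D^*(\mathcal X)$ and $Y^{M^\bullet}$ in the image of $\mathscr D^*(\mathcal Y)$. **Theorem 1.2.** Let $\mathcal X$ and $\mathcal Y$ be full subcategories of $\mathcal A$, and consider the following conditions. (a) $\mathrm{Ext}^n_{\mathcal A}(X,Y)=0$ for all $n\ge 0$, $X\in\mathcal X$ and $Y\in\mathcal Y$. (b) For each object $M\in\mathcal A$ there is an exact sequence $$0\to Y_M\to X_M\to M\to Y^M\to X^M\to 0$$ in $\mathcal A$ with $X_M,X^M\in\mathcal X$ and $Y_M,Y^M\in\mathcal Y$. (c) For each object $M\in\mathcal A$ there are a monomorphism $M\to I$ in $\mathcal A$ and a sequence as in (b) for $I$ with $X^I=0$. (d) For each object $M\in\mathcal A$ there are an epimorphism $P\to M$ in $\mathcal A$ and a sequence as in (b) for $P$ with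 $Y_P=0$. (c') If $M\in\mathcal A$ is injective, then $X^M=0$ in every sequence as in (b) for $M$. (d') If $M\in\mathcal A$ is projective, then $Y_M=0$ in every sequence as in (b) for $M$. (1) If (a), (b), (c) and (d) hold, then $(\mathcal X,\mathcal Y)$ is a $\mathscr D^*$-decomposition of $\mathcal A$. (2) Suppose that $\mathcal A$ has enough projectives and enough injectives. Then $(\mathcal X,\mathcal Y)$ is a $\mathscr D^*$-decomposition of $\mathcal A$ if and only if (a), (b), (c') and (d') hold. -/

import Mathlib

open CategoryTheory CategoryTheory.Limits CategoryTheory.Pretriangulated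

universe w w' v u

namespace DerivedDecomposition

section AbelianSubcategories

variable {A : Type u} [Category.{v} A] [Abelian A]

/-- A full subcategory `P` of an abelian category `A`, closed under isomorphisms, is an *abelian
subcategory* if it contains a zero object and is closed under finite products, kernels and
cokernels in `A`; equivalently, `P` is an abelian category and its inclusion in `A` is exact. -/
class IsAbelianSubcategory (P : ObjectProperty A) : Prop extends
  P.IsClosedUnderIsomorphisms, P.ContainsZero, P.IsClosedUnderFiniteProducts,
  P.IsClosedUnderKernels, P.IsClosedUnderCokernels

/-- The inclusion of an abelian subcategory is left exact. -/
instance (P : ObjectProperty A) [IsAbelianSubcategory P] : PreservesFiniteLimits P.ι := by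
  have : ∀ {X Y : P.FullSubcategory} (f : X ⟶ Y), PreservesLimit (parallelPair f 0) P.ι :=
    fun f => P.preservesKernels_ι f
  exact Functor.preservesFiniteLimits_of_preservesKernels P.ι

/-- The inclusion of an abelian subcategory is right exact. -/
instance (P : ObjectProperty A) [IsAbelianSubcategory P] : PreservesFiniteColimits P.ι := by
  have : ∀ {X Y : P.FullSubcategory} (f : X ⟶ Y), PreservesColimit (parallelPair f 0) P.ι :=
    fun f => P.preservesCokernels_ι f
  exact Functor.preservesFiniteColimits_of_preservesCokernels P.ι

end AbelianSubcategories

/-- The four boundedness conditions `b`, `+`, `-`, `∅` on derived categories. -/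
inductive Boundedness
  | bounded
  | below
  | above
  | unbounded

section DerivedCategories

variable (A : Type u) [Category.{v} A] [Abelian A] [HasDerivedCategory.{w} A]

/-- The objects of the derived category `D(A)` that belong to `D*(A)`: those with bounded
(resp. bounded below, bounded above, arbitrary) cohomology. -/
def Boundedness.prop (s : Boundedness) : ObjectProperty (DerivedCategory A) :=
  match s with
  | .bounded => DerivedCategory.TStructure.t.bounded
  | .below => DerivedCategory.TStructure.t.plus
  | .above => DerivedCategory.TStructure.t.minus
  | .unbounded => ⊤

instance (s : Boundedness) : (s.prop A).IsClosedUnderIsomorphisms := by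
  cases s <;> dsimp only [Boundedness.prop] <;> infer_instance

instance (s : Boundedness) : (s.prop A).IsTriangulated := by
  cases s with
  | bounded => dsimp only [Boundedness.prop]; infer_instance
  | below => dsimp only [Boundedness.prop]; infer_instance
  | above => dsimp only [Boundedness.prop]; infer_instance
  | unbounded =>
    exact
      { exists_zero := (HasZeroObject.zero (C := DerivedCategory A)).imp fun _ h => ⟨h, trivial⟩
        isStableUnderShiftBy := fun _ => ⟨fun _ _ => trivial⟩
        ext₂' := fun T _ _ _ => ObjectProperty.le_isoClosure _ _ trivial }

/-- The derived category `D*(A)`, for `* ∈ {b, +, -, ∅}`, as a full triangulated subcategory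
of `D(A)`. -/
abbrev DStar (s : Boundedness) : Type (max u v) := (s.prop A).FullSubcategory

/-- An object of `A`, seen as a complex concentrated in degree `0`, belongs to `D*(A)`. -/
lemma Boundedness.prop_single (s : Boundedness) (M : A) :
    s.prop A ((DerivedCategory.singleFunctor A 0).obj M) := by
  cases s with
  | bounded => exact ⟨⟨0, inferInstance⟩, ⟨0, inferInstance⟩⟩
  | below => exact ⟨0, inferInstance⟩
  | above => exact ⟨0, inferInstance⟩
  | unbounded => trivial

/-- The embedding `A ⥤ D*(A)` as complexes concentrated in degree `0`. -/
noncomputable def DStar.single (s : Boundedness) : A ⥤ DStar A s :=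
  (s.prop A).lift (DerivedCategory.singleFunctor A 0) (s.prop_single A)

end DerivedCategories

section DerivedInclusion

variable {A : Type u} [Category.{v} A] [Abelian A] [HasDerivedCategory.{w} A]
  (P : ObjectProperty A) [IsAbelianSubcategory P] [HasDerivedCategory.{w'} P.FullSubcategory]

/-- The functor `D(P) ⥤ D(A)` induced by the inclusion of `P` preserves boundedness. -/
lemma Boundedness.prop_map (s : Boundedness) (M : DerivedCategory P.FullSubcategory)
    (hM : s.prop _ M) : s.prop A (P.ι.mapDerivedCategory.obj M) := by
  have hplus : ∀ n : ℤ, DerivedCategory.TStructure.t.IsGE M n →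
      DerivedCategory.TStructure.t.IsGE (P.ι.mapDerivedCategory.obj M) n := by
    rintro n ⟨K, e, _⟩
    exact ⟨_, P.ι.mapDerivedCategory.mapIso e ≪≫ P.ι.mapDerivedCategoryFactors.app K,
      inferInstanceAs (((P.ι.mapHomologicalComplex (ComplexShape.up ℤ)).obj
        K).IsStrictlySupported _)⟩
  have hminus : ∀ n : ℤ, DerivedCategory.TStructure.t.IsLE M n →
      DerivedCategory.TStructure.t.IsLE (P.ι.mapDerivedCategory.obj M) n := by
    rintro n ⟨K, e, _⟩
    exact ⟨_, P.ι.mapDerivedCategory.mapIso e ≪≫ P.ι.mapDerivedCategoryFactors.app K,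
      inferInstanceAs (((P.ι.mapHomologicalComplex (ComplexShape.up ℤ)).obj
        K).IsStrictlySupported _)⟩
  cases s with
  | bounded =>
    obtain ⟨⟨a, ha⟩, ⟨b, hb⟩⟩ := hM
    exact ⟨⟨a, hplus a ha⟩, ⟨b, hminus b hb⟩⟩
  | below =>
    obtain ⟨a, ha⟩ := hM
    exact ⟨a, hplus a ha⟩
  | above =>
    obtain ⟨b, hb⟩ := hM
    exact ⟨b, hminus b hb⟩
  | unbounded => trivial

/-- The functor `D*(P) ⥤ D*(A)` induced by the inclusion of an abelian subcategory `P` of `A`,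
i.e. by termwise application of the inclusion to complexes. -/
noncomputable def derivedInclusion (s : Boundedness) : DStar P.FullSubcategory s ⥤ DStar A s :=
  (s.prop A).lift ((s.prop P.FullSubcategory).ι ⋙ P.ι.mapDerivedCategory)
    (fun M => s.prop_map P M.obj M.property)

end DerivedInclusion

section Decompositions

variable {A : Type u} [Category.{v} A] [Abelian A]

/-- The functor `D*(P) ⥤ D*(A)` of an abelian subcategory `P`, where `D(P)` is the localization of
the category of complexes over `P` that Mathlib constructs. -/
noncomputable def standardDerivedInclusion [HasDerivedCategory.{w} A] (P : ObjectProperty A)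
    [IsAbelianSubcategory P] (s : Boundedness) :
    letI := HasDerivedCategory.standard P.FullSubcategory
    DStar P.FullSubcategory s ⥤ DStar A s :=
  letI := HasDerivedCategory.standard P.FullSubcategory
  derivedInclusion P s

/-- The pair `(X, Y)` of full subcategories is a `D*`-decomposition of the abelian category `A`. -/
structure IsDStarDecomposition [HasDerivedCategory.{w} A] (s : Boundedness)
    (X Y : ObjectProperty A) : Prop where
  /-- (D1) for `X`: it is an abelian subcategory ... -/
  abelian_left : IsAbelianSubcategory X
  /-- (D1) for `Y`: it is an abelian subcategory ... -/
  abelian_right : IsAbelianSubcategory Y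
  /-- ... and `D*(X) ⥤ D*(A)` is fully faithful. -/
  fullyFaithful_left :
    (standardDerivedInclusion X s).Full ∧ (standardDerivedInclusion X s).Faithful
  /-- ... and `D*(Y) ⥤ D*(A)` is fully faithful. -/
  fullyFaithful_right :
    (standardDerivedInclusion Y s).Full ∧ (standardDerivedInclusion Y s).Faithful
  /-- (D2) `Hom(M, N[n]) = 0` in `D*(A)` for all `M` in `X`, `N` in `Y` and `n : ℤ`. -/
  orthogonal : ∀ (M N : A), X M → Y N → ∀ (n : ℤ)
    (f : (DStar.single A s).obj M ⟶ ((DStar.single A s).obj N)⟦n⟧), f = 0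
  /-- (D3) Every object `M` of `D*(A)` lies in a distinguished triangle `X_M ⟶ M ⟶ Y_M ⟶ X_M[1]`
  with `X_M` coming from `D*(X)` and `Y_M` coming from `D*(Y)`. -/
  exists_triangle : ∀ M : DStar A s, ∃ (K : _) (L : _)
    (f : (standardDerivedInclusion X s).obj K ⟶ M)
    (g : M ⟶ (standardDerivedInclusion Y s).obj L)
    (h : (standardDerivedInclusion Y s).obj L ⟶ ((standardDerivedInclusion X s).obj K)⟦(1 : ℤ)⟧),
    Triangle.mk f g h ∈ distTriang (DStar A s)

/-- An exact sequence `0 ⟶ Y₁ ⟶ X₁ ⟶ M ⟶ Y₂ ⟶ X₂ ⟶ 0` with `X₁`, `X₂` in `X` and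
`Y₁`, `Y₂` in `Y`. In the usual notation, `Y₁ = Y_M`, `X₁ = X_M`, `Y₂ = Y^M` and `X₂ = X^M`. -/
structure FiveTermSequence (X Y : ObjectProperty A) (M : A) where
  (Y₁ X₁ Y₂ X₂ : A)
  prop_Y₁ : Y Y₁
  prop_X₁ : X X₁
  prop_Y₂ : Y Y₂
  prop_X₂ : X X₂
  a : Y₁ ⟶ X₁
  b : X₁ ⟶ M
  c : M ⟶ Y₂
  d : Y₂ ⟶ X₂
  mono_a : Mono a
  w₁ : a ≫ b = 0
  exact₁ : (ShortComplex.mk a b w₁).Exact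
  w₂ : b ≫ c = 0
  exact₂ : (ShortComplex.mk b c w₂).Exact
  w₃ : c ≫ d = 0
  exact₃ : (ShortComplex.mk c d w₃).Exact
  epi_d : Epi d

/-- `Ext^n(M, N) = 0` for all `n ≥ 0`, `M` in `X` and `N` in `Y`. -/
def ExtOrthogonal [HasExt.{w'} A] (X Y : ObjectProperty A) : Prop :=
  ∀ (n : ℕ) (M N : A), X M → Y N → ∀ e : Abelian.Ext M N n, e = 0

end Decompositions

end DerivedDecomposition

namespace DerivedDecomposition

/-! ### Image factorizations and five-term exact sequences -/

section ImageFactorization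

variable {A : Type u} [Category.{v} A] [Abelian A]

/-! Sufficiency. Conditions (a) and (b) identify `X` with the objects having no `Hom` and no `Ext¹`
to `Y`, and dually for `Y`. Hence both are abelian subcategories closed under extensions, the
complexes with cohomology in `X` (resp. `Y`) form triangulated subcategories (`cohomologyIn`), and
these meet only in zero because `X` and `Y` do. The same vanishing makes `M ⟶ Y^M` a reflection into
`Y` and `X_M ⟶ M` a coreflection into `X`.

The reflection is not exact, but on the objects of `kernelAcyclic X` its unit has kernel and
cokernel in `X`. By (d) every object is a quotient of such an object, and the class is closed under
subobjects and extensions; so every complex, bounded or not, is resolved by such objects through a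
single mapping cone (`exists_left_resolution`). On such a resolution the termwise unit has a cone
with cohomology in `X`. If the complex has cohomology in `Y`, so does the cone, which is therefore
zero. Thus complexes with cohomology in `Y` come from `D(Y)`, and roofs between complexes over `Y`
can be moved into `Y` (`full_mapDerivedCategory_right`). Faithfulness follows from fullness and
conservativity (`faithful_mapDerivedCategory`). Dually, (c) gives fullness for `X`, and the termwise
counit gives the approximation triangles (`exists_trW_from_left`); boundedness passes to their outer
terms because `X` and `Y` intersect trivially (`Boundedness.prop_obj₁`).

Necessity. The cohomology sequence of the triangle of a stalk complex is a five-term sequence.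
Fullness of `D*(X)` makes the higher extensions between objects of `X` effaceable inside `X`.
Cutting the five-term sequence into three short exact sequences, their Yoneda product lies in
`Ext³(X^M, Y_M) = 0`; effaceability and injectivity of `M` then give `X^M = 0`
(`FiveTermSequence.isZero_X₂_of_injective`), and the projective case is dual. With enough injectives
and projectives, (c') and (d') yield (c) and (d). -/

lemma shortExact_kernel_image {M N : A} (f : M ⟶ N) :
    (ShortComplex.mk (kernel.ι f) (Abelian.factorThruImage f)
      (by simp [← cancel_mono (Abelian.image.ι f)])).ShortExact where
  exact := (ShortComplex.exact_iff_of_epi_of_isIso_of_mono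
    (S₁ := ShortComplex.mk (kernel.ι f) (Abelian.factorThruImage f)
      (by simp [← cancel_mono (Abelian.image.ι f)]))
    (S₂ := ShortComplex.mk (kernel.ι f) f (kernel.condition f))
    { τ₁ := 𝟙 _, τ₂ := 𝟙 _, τ₃ := Abelian.image.ι f }).2 (ShortComplex.kernelSequence_exact f)

lemma shortExact_image_cokernel {M N : A} (f : M ⟶ N) :
    (ShortComplex.mk (Abelian.image.ι f) (cokernel.π f)
      (by simp)).ShortExact where
  exact := ShortComplex.exact_of_f_is_kernel _ (kernelIsKernel _)

/-- An object property closed under kernels, cokernels and extensions contains the middle of a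
five-term exact sequence as soon as it contains the four outer terms. -/
lemma prop_of_exact_five (P : ObjectProperty A) [P.IsClosedUnderIsomorphisms]
    [P.IsClosedUnderKernels] [P.IsClosedUnderCokernels] [P.IsClosedUnderExtensions]
    {M₁ M₂ M₃ M₄ M₅ : A} {f : M₁ ⟶ M₂} {g : M₂ ⟶ M₃} {h : M₃ ⟶ M₄} {k : M₄ ⟶ M₅}
    {w₁ : f ≫ g = 0} {w₂ : g ≫ h = 0} {w₃ : h ≫ k = 0}
    (e₁ : (ShortComplex.mk f g w₁).Exact) (e₂ : (ShortComplex.mk g h w₂).Exact)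
    (e₃ : (ShortComplex.mk h k w₃).Exact) (h₁ : P M₁) (h₂ : P M₂) (h₄ : P M₄) (h₅ : P M₅) :
    P M₃ := by
  have hC := P.prop_cokernel f h₁ h₂
  have hK := P.prop_kernel k h₄ h₅
  have := e₁.mono_cokernelDesc
  have := e₃.epi_kernelLift
  -- The sequence is spliced into a short exact sequence with outer terms `cokernel f` and `kernel
  -- k`.
  have w : cokernel.desc f g w₁ ≫ kernel.lift k h w₃ = 0 := by
    simp [← cancel_mono (kernel.ι k), ← cancel_epi (cokernel.π f), w₂]
  refine P.prop_X₂_of_shortExact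
    (S := ShortComplex.mk (cokernel.desc f g w₁) (kernel.lift k h w₃) w)
    { exact := ?_, mono_f := e₁.mono_cokernelDesc, epi_g := e₃.epi_kernelLift } hC hK
  have w' : cokernel.desc f g w₁ ≫ h = 0 := by simp [← cancel_epi (cokernel.π f), w₂]
  have hexact : (ShortComplex.mk _ _ w').Exact :=
    (ShortComplex.exact_iff_of_epi_of_isIso_of_mono (S₁ := ShortComplex.mk g h w₂)
      (S₂ := ShortComplex.mk _ _ w') { τ₁ := cokernel.π f, τ₂ := 𝟙 _, τ₃ := 𝟙 _ }).1 e₂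
  exact (ShortComplex.exact_iff_of_epi_of_isIso_of_mono (S₁ := ShortComplex.mk _ _ w)
    (S₂ := ShortComplex.mk _ _ w') { τ₁ := 𝟙 _, τ₂ := 𝟙 _, τ₃ := kernel.ι k }).2 hexact

/-- A full subcategory closed under isomorphisms, kernels, cokernels and extensions and containing
a zero object is an abelian subcategory. -/
lemma isAbelianSubcategory_of_extensions (P : ObjectProperty A) [P.IsClosedUnderIsomorphisms]
    [P.ContainsZero] [P.IsClosedUnderKernels] [P.IsClosedUnderCokernels]
    [P.IsClosedUnderExtensions] : IsAbelianSubcategory P where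
  toIsClosedUnderFiniteProducts := by
    have : P.IsClosedUnderBinaryProducts := ⟨by
      rintro M ⟨p⟩
      have hM := P.prop_biprod (p.prop_diag_obj (.mk .left)) (p.prop_diag_obj (.mk .right))
      exact P.prop_of_iso (IsLimit.conePointsIsoOfNatIso (BinaryBiproduct.isLimit _ _) p.isLimit
        (Iso.symm (diagramIsoPair _))) hM⟩
    exact .mk'

end ImageFactorization

/-! ### Orthogonal classes are abelian subcategories -/

section Orthogonality

open Abelian ZeroObject

variable {A : Type u} [Category.{v} A] [Abelian A] [HasExt.{w'} A] {X Y : ObjectProperty A}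

lemma ExtOrthogonal.hom_eq_zero (hXY : ExtOrthogonal X Y) {M N : A} (hM : X M) (hN : Y N)
    (f : M ⟶ N) : f = 0 := by
  simpa using hXY 0 M N hM hN (Ext.mk₀ f)

lemma ExtOrthogonal.isZero (hXY : ExtOrthogonal X Y) {M : A} (hX : X M) (hY : Y M) :
    IsZero M :=
  (IsZero.iff_id_eq_zero M).2 (hXY.hom_eq_zero hX hY _)

/-- Under the orthogonality and approximation hypotheses, the right class is determined by the
vanishing of `Hom` and `Ext¹` from the left class. -/
lemma prop_right_of_ext [Y.IsClosedUnderIsomorphisms] (hXY : ExtOrthogonal X Y) {M : A}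
    (E : FiveTermSequence X Y M)
    (h₀ : ∀ (N : A), X N → ∀ f : N ⟶ M, f = 0)
    (h₁ : ∀ (N : A), X N → ∀ e : Ext N M 1, e = 0) : Y M := by
  have : Mono E.c := E.exact₂.mono_g (h₀ _ E.prop_X₁ _)
  have hS : (ShortComplex.mk E.c E.d E.w₃).ShortExact :=
    { exact := E.exact₃, epi_g := E.epi_d }
  obtain ⟨x, hx⟩ := Ext.covariant_sequence_exact₃ E.X₂ hS (Ext.mk₀ (𝟙 E.X₂)) (zero_add 1)
    (h₁ _ E.prop_X₂ _)
  -- As `Ext¹(X₂, M) = 0`, the identity of `X₂` lifts through `d`; but a map from `X₂` to `Y₂` is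
  -- zero.
  have hX₂ : IsZero E.X₂ := by
    rw [IsZero.iff_id_eq_zero, ← Ext.mk₀_eq_zero_iff.{w'}, ← hx,
      hXY 0 _ _ E.prop_X₂ E.prop_Y₂ x, Ext.zero_comp]
  have : Epi E.c := E.exact₃.epi_f (hX₂.eq_of_tgt _ _)
  have := isIso_of_mono_of_epi E.c
  exact Y.prop_of_iso (asIso E.c).symm E.prop_Y₂

/-- Under the orthogonality and approximation hypotheses, the left class is determined by the
vanishing of `Hom` and `Ext¹` to the right class. -/
lemma prop_left_of_ext [X.IsClosedUnderIsomorphisms] (hXY : ExtOrthogonal X Y) {M : A}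
    (E : FiveTermSequence X Y M)
    (h₀ : ∀ (N : A), Y N → ∀ f : M ⟶ N, f = 0)
    (h₁ : ∀ (N : A), Y N → ∀ e : Ext M N 1, e = 0) : X M := by
  have : Epi E.b := E.exact₂.epi_f (h₀ _ E.prop_Y₂ _)
  have hS : (ShortComplex.mk E.a E.b E.w₁).ShortExact :=
    { exact := E.exact₁, mono_f := E.mono_a }
  obtain ⟨x, hx⟩ := Ext.contravariant_sequence_exact₁ hS E.Y₁ (Ext.mk₀ (𝟙 E.Y₁)) (add_zero 1)
    (h₁ _ E.prop_Y₁ _)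
  have hY₁ : IsZero E.Y₁ := by
    rw [IsZero.iff_id_eq_zero, ← Ext.mk₀_eq_zero_iff.{w'}, ← hx,
      hXY 0 _ _ E.prop_X₁ E.prop_Y₁ x, Ext.comp_zero]
  have : Mono E.b := E.exact₁.mono_g (hY₁.eq_of_src _ _)
  have := isIso_of_mono_of_epi E.b
  exact X.prop_of_iso (asIso E.b) E.prop_X₁

section Right

variable [Y.IsClosedUnderIsomorphisms] (hXY : ExtOrthogonal X Y)
  (hE : ∀ M : A, Nonempty (FiveTermSequence X Y M))
include hXY hE

lemma isClosedUnderExtensions_right : Y.IsClosedUnderExtensions where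
  prop_X₂_of_shortExact {S} hS h₁ h₃ := by
    have key (n : ℕ) (N : A) (hN : X N) (e : Ext N S.X₂ n) : e = 0 := by
      obtain ⟨x, rfl⟩ := Ext.covariant_sequence_exact₂ N hS e (hXY n _ _ hN h₃ _)
      rw [hXY n _ _ hN h₁ x, Ext.zero_comp]
    exact prop_right_of_ext hXY (hE _).some
      (fun N hN f => by simpa using key 0 N hN (Ext.mk₀ f)) (key 1)

/-- Only `Hom`-vanishing is asked of the quotient: this suffices to kill `Ext¹` into `S.X₁`, and it
holds for the image of a map in `Y` before that image is known to lie in `Y`. -/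
lemma prop_right_X₁ {S : ShortComplex A} (hS : S.ShortExact) (h₂ : Y S.X₂)
    (h₃ : ∀ (N : A), X N → ∀ f : N ⟶ S.X₃, f = 0) : Y S.X₁ := by
  have := hS.mono_f
  refine prop_right_of_ext hXY (hE _).some (fun N hN f => ?_) (fun N hN e => ?_)
  · rw [← cancel_mono S.f, zero_comp]
    exact hXY.hom_eq_zero hN h₂ _
  · obtain ⟨x, rfl⟩ := Ext.covariant_sequence_exact₁ N hS e (hXY 1 _ _ hN h₂ _) (zero_add 1)
    obtain ⟨f, rfl⟩ := Ext.addEquiv₀.symm.surjective x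
    simp [h₃ N hN f]

lemma prop_right_X₃ {S : ShortComplex A} (hS : S.ShortExact) (h₁ : Y S.X₁) (h₂ : Y S.X₂) :
    Y S.X₃ := by
  have key (n : ℕ) (N : A) (hN : X N) (e : Ext N S.X₃ n) : e = 0 := by
    obtain ⟨x, rfl⟩ := Ext.covariant_sequence_exact₃ N hS e rfl (hXY _ _ _ hN h₁ _)
    rw [hXY n _ _ hN h₂ x, Ext.zero_comp]
  exact prop_right_of_ext hXY (hE _).some
    (fun N hN f => by simpa using key 0 N hN (Ext.mk₀ f)) (key 1)

lemma prop_right_kernel {M N : A} (f : M ⟶ N) (hM : Y M) (hN : Y N) : Y (kernel f) :=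
  prop_right_X₁ hXY hE (shortExact_kernel_image f) hM (fun L hL g => by
    rw [← cancel_mono (Abelian.image.ι f), zero_comp]
    exact hXY.hom_eq_zero hL hN _)

/-- The kernel is in `Y`, so the image is a quotient of two objects of `Y`, and then so is the
cokernel. -/
lemma prop_right_cokernel {M N : A} (f : M ⟶ N) (hM : Y M) (hN : Y N) : Y (cokernel f) :=
  prop_right_X₃ hXY hE (shortExact_image_cokernel f)
    (prop_right_X₃ hXY hE (shortExact_kernel_image f) (prop_right_kernel hXY hE f hM hN) hM) hN

lemma isAbelianSubcategory_right : IsAbelianSubcategory Y := by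
  have : Y.ContainsZero := ⟨0, isZero_zero A, prop_right_of_ext hXY (hE 0).some
    (fun N _ f => (isZero_zero A).eq_of_tgt _ _)
    (fun N _ e => by
      rw [← Ext.comp_mk₀_id e, (isZero_zero A).eq_of_src (𝟙 0) 0, Ext.mk₀_zero, Ext.comp_zero])⟩
  have : Y.IsClosedUnderKernels := ⟨by
    rintro _ ⟨f, k, hk, hf⟩
    exact Y.prop_of_iso ((kernelIsKernel f).conePointUniqueUpToIso hk)
      (prop_right_kernel hXY hE f hf.1 hf.2)⟩
  have : Y.IsClosedUnderCokernels := ⟨by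
    rintro _ ⟨f, k, hk, hf⟩
    exact Y.prop_of_iso ((cokernelIsCokernel f).coconePointUniqueUpToIso hk)
      (prop_right_cokernel hXY hE f hf.1 hf.2)⟩
  have := isClosedUnderExtensions_right hXY hE
  exact isAbelianSubcategory_of_extensions Y

end Right

section Left

variable [X.IsClosedUnderIsomorphisms] (hXY : ExtOrthogonal X Y)
  (hE : ∀ M : A, Nonempty (FiveTermSequence X Y M))
include hXY hE

lemma isClosedUnderExtensions_left : X.IsClosedUnderExtensions where
  prop_X₂_of_shortExact {S} hS h₁ h₃ := by
    have key (n : ℕ) (N : A) (hN : Y N) (e : Ext S.X₂ N n) : e = 0 := by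
      obtain ⟨x, rfl⟩ := Ext.contravariant_sequence_exact₂ hS N e (hXY n _ _ h₁ hN _)
      rw [hXY n _ _ h₃ hN x, Ext.comp_zero]
    exact prop_left_of_ext hXY (hE _).some
      (fun N hN f => by simpa using key 0 N hN (Ext.mk₀ f)) (key 1)

lemma prop_left_X₃ {S : ShortComplex A} (hS : S.ShortExact) (h₂ : X S.X₂)
    (h₁ : ∀ (N : A), Y N → ∀ f : S.X₁ ⟶ N, f = 0) : X S.X₃ := by
  have := hS.epi_g
  refine prop_left_of_ext hXY (hE _).some (fun N hN f => ?_) (fun N hN e => ?_)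
  · rw [← cancel_epi S.g, comp_zero]
    exact hXY.hom_eq_zero h₂ hN _
  · obtain ⟨x, rfl⟩ := Ext.contravariant_sequence_exact₃ hS N e (hXY 1 _ _ h₂ hN _) (add_zero 1)
    obtain ⟨f, rfl⟩ := Ext.addEquiv₀.symm.surjective x
    simp [h₁ N hN f]

lemma prop_left_X₁ {S : ShortComplex A} (hS : S.ShortExact) (h₂ : X S.X₂) (h₃ : X S.X₃) :
    X S.X₁ := by
  have key (n : ℕ) (N : A) (hN : Y N) (e : Ext S.X₁ N n) : e = 0 := by
    obtain ⟨x, rfl⟩ := Ext.contravariant_sequence_exact₁ hS N e rfl (hXY _ _ _ h₃ hN _)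
    rw [hXY n _ _ h₂ hN x, Ext.comp_zero]
  exact prop_left_of_ext hXY (hE _).some
    (fun N hN f => by simpa using key 0 N hN (Ext.mk₀ f)) (key 1)

/-- On this side the cokernel comes before the kernel: the image is a quotient of `M`, so it has no
maps to `Y`. -/
lemma prop_left_cokernel {M N : A} (f : M ⟶ N) (hM : X M) (hN : X N) : X (cokernel f) :=
  prop_left_X₃ hXY hE (shortExact_image_cokernel f) hN (fun L hL g => by
    rw [← cancel_epi (Abelian.factorThruImage f), comp_zero]
    exact hXY.hom_eq_zero hM hL _)

lemma prop_left_kernel {M N : A} (f : M ⟶ N) (hM : X M) (hN : X N) : X (kernel f) :=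
  prop_left_X₁ hXY hE (shortExact_kernel_image f) hM
    (prop_left_X₁ hXY hE (shortExact_image_cokernel f) hN (prop_left_cokernel hXY hE f hM hN))

lemma isAbelianSubcategory_left : IsAbelianSubcategory X := by
  have : X.ContainsZero := ⟨0, isZero_zero A, prop_left_of_ext hXY (hE 0).some
    (fun N _ f => (isZero_zero A).eq_of_src _ _)
    (fun N _ e => by
      rw [← Ext.mk₀_id_comp e, (isZero_zero A).eq_of_src (𝟙 0) 0, Ext.mk₀_zero, Ext.zero_comp])⟩
  have : X.IsClosedUnderKernels := ⟨by
    rintro _ ⟨f, k, hk, hf⟩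
    exact X.prop_of_iso ((kernelIsKernel f).conePointUniqueUpToIso hk)
      (prop_left_kernel hXY hE f hf.1 hf.2)⟩
  have : X.IsClosedUnderCokernels := ⟨by
    rintro _ ⟨f, k, hk, hf⟩
    exact X.prop_of_iso ((cokernelIsCokernel f).coconePointUniqueUpToIso hk)
      (prop_left_cokernel hXY hE f hf.1 hf.2)⟩
  have := isClosedUnderExtensions_left hXY hE
  exact isAbelianSubcategory_of_extensions X

end Left

end Orthogonality

/-! ### Objects adapted to the reflection and the coreflection -/

section Acyclic

variable {A : Type u} [Category.{v} A] [Abelian A]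

/-- The objects `M` such that the kernel of every morphism from an object of `X` to `M`
belongs to `X`. -/
def kernelAcyclic (X : ObjectProperty A) : ObjectProperty A :=
  fun M => ∀ (N : A) (f : N ⟶ M), X N → X (kernel f)

/-- The objects `M` such that the cokernel of every morphism from `M` to an object of `Y`
belongs to `Y`. -/
def cokernelAcyclic (Y : ObjectProperty A) : ObjectProperty A :=
  fun M => ∀ (N : A) (f : M ⟶ N), Y N → Y (cokernel f)

section

variable (X : ObjectProperty A) [X.IsClosedUnderIsomorphisms]

lemma kernelAcyclic_of_mono {M N : A} (i : M ⟶ N) [Mono i] (hN : kernelAcyclic X N) :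
    kernelAcyclic X M := fun _ f hL =>
  X.prop_of_iso (kernelCompMono f i) (hN _ (f ≫ i) hL)

/-- The kernel of `f` is computed in two stages: first that of `f ≫ S.g`, then that of the induced
map to `S.X₁`. -/
lemma kernelAcyclic_of_shortExact {S : ShortComplex A} (hS : S.ShortExact)
    (h₁ : kernelAcyclic X S.X₁) (h₃ : kernelAcyclic X S.X₃) : kernelAcyclic X S.X₂ := by
  intro N f hN
  have := hS.mono_f
  let k := hS.exact.lift (kernel.ι (f ≫ S.g) ≫ f) (by simp)
  have hk : k ≫ S.f = kernel.ι (f ≫ S.g) ≫ f := hS.exact.lift_f _ _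
  refine X.prop_of_iso ?_ (h₁ _ k (h₃ _ (f ≫ S.g) hN))
  exact
    { hom := kernel.lift _ (kernel.ι k ≫ kernel.ι (f ≫ S.g)) (by
        rw [Category.assoc, ← hk, kernel.condition_assoc, zero_comp])
      inv := kernel.lift _ (kernel.lift _ (kernel.ι f) (by simp)) (by
        simp [← cancel_mono S.f, hk])
      hom_inv_id := by
        simp [← cancel_mono (kernel.ι k), ← cancel_mono (kernel.ι (f ≫ S.g))]
      inv_hom_id := by simp [← cancel_mono (kernel.ι f)] }

instance : (kernelAcyclic X).IsClosedUnderIsomorphisms where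
  of_iso e h := kernelAcyclic_of_mono X e.inv h

instance : (kernelAcyclic X).IsClosedUnderExtensions where
  prop_X₂_of_shortExact hS h₁ h₃ := kernelAcyclic_of_shortExact X hS h₁ h₃

end

section

variable (Y : ObjectProperty A) [Y.IsClosedUnderIsomorphisms]

lemma cokernelAcyclic_of_epi {M N : A} (p : M ⟶ N) [Epi p] (hM : cokernelAcyclic Y M) :
    cokernelAcyclic Y N := fun _ f hL =>
  Y.prop_of_iso (cokernelEpiComp p f) (hM _ (p ≫ f) hL)

lemma cokernelAcyclic_of_shortExact {S : ShortComplex A} (hS : S.ShortExact)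
    (h₁ : cokernelAcyclic Y S.X₁) (h₃ : cokernelAcyclic Y S.X₃) : cokernelAcyclic Y S.X₂ := by
  intro N f hN
  have := hS.epi_g
  let k := hS.exact.desc (f ≫ cokernel.π (S.f ≫ f)) (by
    rw [← Category.assoc, cokernel.condition])
  have hk : S.g ≫ k = f ≫ cokernel.π (S.f ≫ f) := hS.exact.g_desc _ _
  refine Y.prop_of_iso ?_ (h₃ _ k (h₁ _ (S.f ≫ f) hN))
  exact
    { hom := cokernel.desc _ (cokernel.desc _ (cokernel.π f) (by simp)) (by
        simp [← cancel_epi S.g, reassoc_of% hk])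
      inv := cokernel.desc _ (cokernel.π (S.f ≫ f) ≫ cokernel.π k) (by
        rw [← reassoc_of% hk, cokernel.condition, comp_zero])
      hom_inv_id := by
        simp [← cancel_epi (cokernel.π k), ← cancel_epi (cokernel.π (S.f ≫ f))]
      inv_hom_id := by simp [← cancel_epi (cokernel.π f)] }

instance : (cokernelAcyclic Y).IsClosedUnderIsomorphisms where
  of_iso e h := cokernelAcyclic_of_epi Y e.hom h

instance : (cokernelAcyclic Y).IsClosedUnderExtensions where
  prop_X₂_of_shortExact hS h₁ h₃ := cokernelAcyclic_of_shortExact Y hS h₁ h₃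

end

end Acyclic

/-! ### Universal properties of five-term sequences -/

namespace FiveTermSequence

open Abelian

variable {A : Type u} [Category.{v} A] [Abelian A] {X Y : ObjectProperty A}
  {M : A} (E : FiveTermSequence X Y M)

attribute [instance] mono_a epi_d

/-- The left part of a five-term sequence is the kernel of its second map. -/
noncomputable def kernelIso : kernel E.b ≅ E.Y₁ :=
  (kernelIsKernel E.b).conePointUniqueUpToIso E.exact₁.fIsKernel

/-- The right part of a five-term sequence is the cokernel of its third map. -/
noncomputable def cokernelIso : cokernel E.c ≅ E.X₂ :=
  (cokernelIsCokernel E.c).coconePointUniqueUpToIso E.exact₃.gIsCokernel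

lemma shortExact_kernel_d : (ShortComplex.mk (kernel.ι E.d) E.d (by simp)).ShortExact where
  exact := ShortComplex.exact_of_f_is_kernel _ (kernelIsKernel _)

lemma shortExact_cokernel_a : (ShortComplex.mk E.a (cokernel.π E.a) (by simp)).ShortExact where
  exact := ShortComplex.exact_of_g_is_cokernel _ (cokernelIsCokernel _)

/-- The middle part of a five-term sequence as a short exact sequence. -/
lemma shortExact_middle :
    (ShortComplex.mk (cokernel.desc E.a E.b E.w₁) (kernel.lift E.d E.c E.w₃) (by
      simp [← cancel_mono (kernel.ι E.d), ← cancel_epi (cokernel.π E.a), E.w₂])).ShortExact := by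
  have w : cokernel.desc E.a E.b E.w₁ ≫ E.c = 0 := by
    simp [← cancel_epi (cokernel.π E.a), E.w₂]
  have h : (ShortComplex.mk _ _ w).Exact :=
    (ShortComplex.exact_iff_of_epi_of_isIso_of_mono (S₁ := ShortComplex.mk E.b E.c E.w₂)
      (S₂ := ShortComplex.mk _ _ w) { τ₁ := cokernel.π E.a, τ₂ := 𝟙 _, τ₃ := 𝟙 _ }).1 E.exact₂
  exact
    { mono_f := E.exact₁.mono_cokernelDesc
      epi_g := E.exact₃.epi_kernelLift
      exact := (ShortComplex.exact_iff_of_epi_of_isIso_of_mono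
        (S₁ := ShortComplex.mk (cokernel.desc E.a E.b E.w₁) (kernel.lift E.d E.c E.w₃) (by
          simp [← cancel_mono (kernel.ι E.d), ← cancel_epi (cokernel.π E.a), E.w₂]))
        (S₂ := ShortComplex.mk _ _ w) { τ₁ := 𝟙 _, τ₂ := 𝟙 _, τ₃ := kernel.ι E.d }).2 h }

section

variable [HasExt.{w'} A] (hXY : ExtOrthogonal X Y)
include hXY

/-- The map kills the image of `X₁`, hence descends to `kernel E.d`; the obstruction to extending it
to `Y₂` lies in `Ext¹(X₂, N) = 0`. -/
lemma exists_comp_c_eq {N : A} (hN : Y N) (f : M ⟶ N) : ∃ g : E.Y₂ ⟶ N, E.c ≫ g = f := by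
  have hS := E.shortExact_middle
  have := hS.epi_g
  obtain ⟨f', hf'⟩ := hS.exact.desc' f (by
    simp [← cancel_epi (cokernel.π E.a), hXY.hom_eq_zero E.prop_X₁ hN (E.b ≫ f)])
  obtain ⟨x, hx⟩ := Ext.contravariant_sequence_exact₁ E.shortExact_kernel_d N (Ext.mk₀ f')
    (add_zero 1) (hXY _ _ _ E.prop_X₂ hN _)
  obtain ⟨g, rfl⟩ := Ext.addEquiv₀.symm.surjective x
  have hg : kernel.ι E.d ≫ g = f' := Ext.addEquiv₀.symm.injective (by simpa using hx)
  exact ⟨g, by rw [← hf', ← hg]; simp⟩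

lemma exists_comp_b_eq {N : A} (hN : X N) (f : N ⟶ M) : ∃ g : N ⟶ E.X₁, g ≫ E.b = f := by
  have hS := E.shortExact_middle
  have := hS.mono_f
  obtain ⟨f', hf'⟩ := hS.exact.lift' f (by
    simp [← cancel_mono (kernel.ι E.d), hXY.hom_eq_zero hN E.prop_Y₂ (f ≫ E.c)])
  obtain ⟨x, hx⟩ := Ext.covariant_sequence_exact₃ N E.shortExact_cokernel_a (Ext.mk₀ f')
    (zero_add 1) (hXY _ _ _ hN E.prop_Y₁ _)
  obtain ⟨g, rfl⟩ := Ext.addEquiv₀.symm.surjective x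
  have hg : g ≫ cokernel.π E.a = f' := Ext.addEquiv₀.symm.injective (by simpa using hx)
  exact ⟨g, by rw [← hf', ← hg]; simp⟩

lemma eq_of_c_comp_eq {N : A} (hN : Y N) {f g : E.Y₂ ⟶ N} (h : E.c ≫ f = E.c ≫ g) : f = g := by
  obtain ⟨k, hk⟩ := E.exact₃.desc' (f - g) (by simp [h])
  rw [← sub_eq_zero, ← hk, hXY.hom_eq_zero E.prop_X₂ hN k]
  exact comp_zero

lemma eq_of_comp_b_eq {N : A} (hN : X N) {f g : N ⟶ E.X₁} (h : f ≫ E.b = g ≫ E.b) : f = g := by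
  obtain ⟨k, hk⟩ := E.exact₁.lift' (f - g) (by simp [h])
  rw [← sub_eq_zero, ← hk, hXY.hom_eq_zero hN E.prop_Y₁ k]
  exact zero_comp

/-- The universal property of the third map of a five-term sequence. -/
noncomputable def rightEquiv (N : Y.FullSubcategory) :
    ((⟨E.Y₂, E.prop_Y₂⟩ : Y.FullSubcategory) ⟶ N) ≃ (M ⟶ N.obj) :=
  Equiv.ofBijective (fun f => E.c ≫ f.hom)
    ⟨fun _ _ h => ObjectProperty.hom_ext _ (E.eq_of_c_comp_eq hXY N.property h), fun f => by
      obtain ⟨g, hg⟩ := E.exists_comp_c_eq hXY N.property f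
      exact ⟨ObjectProperty.homMk g, hg⟩⟩

/-- The universal property of the second map of a five-term sequence. -/
noncomputable def leftEquiv (N : X.FullSubcategory) :
    (N.obj ⟶ M) ≃ (N ⟶ (⟨E.X₁, E.prop_X₁⟩ : X.FullSubcategory)) :=
  (Equiv.ofBijective (fun (f : N ⟶ (⟨E.X₁, E.prop_X₁⟩ : X.FullSubcategory)) => f.hom ≫ E.b)
    ⟨fun _ _ h => ObjectProperty.hom_ext _ (E.eq_of_comp_b_eq hXY N.property h), fun f => by
      obtain ⟨g, hg⟩ := E.exists_comp_b_eq hXY N.property f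
      exact ⟨ObjectProperty.homMk g, hg⟩⟩).symm

/-- When `b` is mono, a map from `X` to `M` has the same kernel as its lift to `X₁`, which is a map
in `X`. This turns condition (d) into a supply of acyclic objects. -/
lemma kernelAcyclic_of_isZero [IsAbelianSubcategory X] (h : IsZero E.Y₁) :
    kernelAcyclic X M := by
  intro N f hN
  obtain ⟨g, rfl⟩ := E.exists_comp_b_eq hXY hN f
  have : Mono E.b := E.exact₁.mono_g (h.eq_of_src _ _)
  exact X.prop_of_iso (kernelCompMono g E.b).symm (X.prop_kernel g hN E.prop_X₁)

lemma cokernelAcyclic_of_isZero [IsAbelianSubcategory Y] (h : IsZero E.X₂) :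
    cokernelAcyclic Y M := by
  intro N f hN
  obtain ⟨g, rfl⟩ := E.exists_comp_c_eq hXY hN f
  have : Epi E.c := E.exact₃.epi_f (h.eq_of_tgt _ _)
  exact Y.prop_of_iso (cokernelEpiComp E.c g).symm (Y.prop_cokernel g E.prop_Y₂ hN)

end

/-- By exactness `X₁` covers `kernel E.c`, a subobject of `M`. Acyclicity puts the kernel of this
cover in `X`, so `kernel E.c` is a cokernel of a map in `X`. -/
lemma prop_kernel_c [IsAbelianSubcategory X] (hM : kernelAcyclic X M) : X (kernel E.c) := by
  have := E.exact₂.epi_kernelLift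
  have h : X (kernel (kernel.lift E.c E.b E.w₂)) :=
    kernelAcyclic_of_mono X (kernel.ι E.c) hM _ _ E.prop_X₁
  have h' := X.prop_cokernel (kernel.ι (kernel.lift E.c E.b E.w₂)) h E.prop_X₁
  exact X.prop_of_iso ((cokernelIsCokernel _).coconePointUniqueUpToIso
    (Abelian.epiIsCokernelOfKernel _ (kernelIsKernel (kernel.lift E.c E.b E.w₂)))) h'

lemma prop_cokernel_b [IsAbelianSubcategory Y] (hM : cokernelAcyclic Y M) :
    Y (cokernel E.b) := by
  have := E.exact₂.mono_cokernelDesc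
  have h : Y (cokernel (cokernel.desc E.b E.c E.w₂)) :=
    cokernelAcyclic_of_epi Y (cokernel.π E.b) hM _ _ E.prop_Y₂
  have h' := Y.prop_kernel (cokernel.π (cokernel.desc E.b E.c E.w₂)) E.prop_Y₂ h
  exact Y.prop_of_iso ((kernelIsKernel _).conePointUniqueUpToIso
    (Abelian.monoIsKernelOfCokernel _ (cokernelIsCokernel (cokernel.desc E.b E.c E.w₂)))) h'

end FiveTermSequence

/-! ### Reflection and coreflection functors -/

section Adjoints

open Abelian

variable {A : Type u} [Category.{v} A] [Abelian A] [HasExt.{w'} A] {X Y : ObjectProperty A}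

/-- The right class is reflective, with reflections given by the five-term sequences. -/
lemma exists_leftAdjoint (hXY : ExtOrthogonal X Y)
    (hE : ∀ M : A, Nonempty (FiveTermSequence X Y M)) :
    ∃ (G : A ⥤ Y.FullSubcategory) (adj : G ⊣ Y.ι), ∀ M : A,
      ∃ E : FiveTermSequence X Y M, Nonempty (Arrow.mk (adj.unit.app M) ≅ Arrow.mk E.c) := by
  let e (M : A) (N : Y.FullSubcategory) := (hE M).some.rightEquiv hXY N
  refine ⟨_, Adjunction.adjunctionOfEquivLeft (G := Y.ι) e (fun M N N' g h => ?_), fun M => ?_⟩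
  · exact (Category.assoc _ _ _).symm
  · refine ⟨(hE M).some, ⟨Arrow.isoMk (Iso.refl _) (Iso.refl _) ?_⟩⟩
    simp only [Arrow.mk_hom, Iso.refl_hom, Category.id_comp, Category.comp_id]
    exact (Category.comp_id _).symm

/-- The left class is coreflective, with coreflections given by the five-term sequences. -/
lemma exists_rightAdjoint (hXY : ExtOrthogonal X Y)
    (hE : ∀ M : A, Nonempty (FiveTermSequence X Y M)) :
    ∃ (F : A ⥤ X.FullSubcategory) (adj : X.ι ⊣ F), ∀ M : A,
      ∃ E : FiveTermSequence X Y M, Nonempty (Arrow.mk (adj.counit.app M) ≅ Arrow.mk E.b) := by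
  let e (N : X.FullSubcategory) (M : A) := (hE M).some.leftEquiv hXY N
  refine ⟨_, Adjunction.adjunctionOfEquivRight (F := X.ι) e (fun N' N M f g => ?_), fun M => ?_⟩
  · apply ((hE M).some.leftEquiv hXY N').symm.injective
    obtain ⟨g, rfl⟩ := ((hE M).some.leftEquiv hXY N).symm.surjective g
    rw [Equiv.symm_apply_apply]
    dsimp only [e]
    rw [Equiv.apply_symm_apply]
    exact (Category.assoc f.hom g.hom _).symm
  · refine ⟨(hE M).some, ⟨Arrow.isoMk (Iso.refl _) (Iso.refl _) ?_⟩⟩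
    simp only [Arrow.mk_hom, Iso.refl_hom, Category.id_comp, Category.comp_id]
    exact (Category.id_comp _).symm

end Adjoints

/-! ### Derived objects with cohomology in a given class -/

section CohomologyIn

variable {A : Type u} [Category.{v} A] [Abelian A] [HasDerivedCategory.{w} A]

/-- The objects of the derived category whose cohomology objects all satisfy `P`. -/
def cohomologyIn (P : ObjectProperty A) : ObjectProperty (DerivedCategory A) :=
  fun M => ∀ n : ℤ, P ((DerivedCategory.homologyFunctor A n).obj M)

instance (P : ObjectProperty A) [P.IsClosedUnderIsomorphisms] :
    (cohomologyIn P).IsClosedUnderIsomorphisms where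
  of_iso e h n := P.prop_of_iso ((DerivedCategory.homologyFunctor A n).mapIso e) (h n)

lemma cohomologyIn_Q_obj_iff (P : ObjectProperty A) [P.IsClosedUnderIsomorphisms]
    (K : CochainComplex A ℤ) :
    cohomologyIn P (DerivedCategory.Q.obj K) ↔ ∀ n, P (K.homology n) :=
  forall_congr' fun n =>
    P.prop_iff_of_iso ((DerivedCategory.homologyFunctorFactors A n).app K)

/-- An object of the derived category with zero cohomology is zero. -/
lemma isZero_of_homology {M : DerivedCategory A}
    (hM : ∀ n, IsZero ((DerivedCategory.homologyFunctor A n).obj M)) : IsZero M := by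
  rw [IsZero.iff_id_eq_zero]
  refine isIsoZeroSelfEquiv M ((DerivedCategory.isIso_iff A _).2 fun n => ?_)
  exact ⟨0, (hM n).eq_of_src _ _, (hM n).eq_of_src _ _⟩

variable (P : ObjectProperty A) [IsAbelianSubcategory P]

omit [HasDerivedCategory A] in
lemma prop_homology {S : ShortComplex A} (h₁ : P S.X₁) (h₂ : P S.X₂) (h₃ : P S.X₃) :
    P S.homology := by
  have hc : P S.cycles := P.prop_of_iso S.cyclesIsoKernel.symm (P.prop_kernel S.g h₂ h₃)
  exact P.prop_of_iso ((cokernelIsCokernel S.toCycles).coconePointUniqueUpToIso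
    S.homologyIsCokernel) (P.prop_cokernel S.toCycles h₁ hc)

lemma cohomologyIn_Q_obj {K : CochainComplex A ℤ} (hK : ∀ n, P (K.X n)) :
    cohomologyIn P (DerivedCategory.Q.obj K) :=
  (cohomologyIn_Q_obj_iff P K).2 fun _ => prop_homology P (hK _) (hK _) (hK _)

variable [P.IsClosedUnderExtensions]

instance : (cohomologyIn P).IsTriangulated where
  exists_zero := ⟨_, isZero_zero _, fun n =>
    P.prop_of_isZero (Functor.map_isZero _ (isZero_zero _))⟩
  isStableUnderShiftBy a := ⟨fun M hM n =>
    P.prop_of_iso (((DerivedCategory.homologyFunctor A 0).shiftIso a n (a + n) rfl).symm.app M)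
      (hM (a + n))⟩
  toIsTriangulatedClosed₂ := .mk' fun T hT h₁ h₃ n =>
    prop_of_exact_five P
      (DerivedCategory.HomologySequence.exact₁ T hT (n - 1) n (by simp))
      (DerivedCategory.HomologySequence.exact₂ T hT n)
      (DerivedCategory.HomologySequence.exact₃ T hT n (n + 1) rfl) (h₃ _) (h₁ _) (h₃ _) (h₁ _)

/-- A morphism of complexes whose kernel and cokernel are termwise in `P` has a cone with
cohomology in `P`. -/
lemma trW_Q_map {K L : CochainComplex A ℤ} (φ : K ⟶ L)
    (h₁ : ∀ n, P (kernel (φ.f n))) (h₂ : ∀ n, P (cokernel (φ.f n))) :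
    (cohomologyIn P).trW (DerivedCategory.Q.map φ) := by
  rw [← Abelian.image.fac φ, Functor.map_comp]
  -- The map onto the image has the kernel complex as fibre, and the inclusion of the image has the
  -- cokernel complex as cone.
  refine MorphismProperty.comp_mem _ _ _ ?_ ?_
  · refine ObjectProperty.trW.mk' _
      (DerivedCategory.triangleOfSES_distinguished (shortExact_kernel_image φ))
      (cohomologyIn_Q_obj P fun n => ?_)
    exact P.prop_of_iso
      (PreservesKernel.iso (HomologicalComplex.eval A (ComplexShape.up ℤ) n) φ).symm (h₁ n)
  · refine ObjectProperty.trW.mk _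
      (DerivedCategory.triangleOfSES_distinguished (shortExact_image_cokernel φ))
      (cohomologyIn_Q_obj P fun n => ?_)
    exact P.prop_of_iso
      (PreservesCokernel.iso (HomologicalComplex.eval A (ComplexShape.up ℤ) n) φ).symm (h₂ n)

/-- The cohomology of the cone lies in both classes, hence vanishes. -/
lemma isIso_of_trW {X Y : ObjectProperty A} [IsAbelianSubcategory X] [X.IsClosedUnderExtensions]
    [IsAbelianSubcategory Y] [Y.IsClosedUnderExtensions]
    (hXY : ∀ M, X M → Y M → IsZero M) {M N : DerivedCategory A} (f : M ⟶ N)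
    (hf : (cohomologyIn X).trW f) (hM : cohomologyIn Y M) (hN : cohomologyIn Y N) : IsIso f := by
  obtain ⟨C, g, h, hT⟩ := distinguished_cocone_triangle f
  have hX : cohomologyIn X C := ((cohomologyIn X).trW_iff_of_distinguished _ hT).1 hf
  have hY : cohomologyIn Y C := (cohomologyIn Y).ext_of_isTriangulatedClosed₃ _ hT hM hN
  refine (Triangle.isZero₃_iff_isIso₁ _ hT).1 ?_
  exact isZero_of_homology fun n => hXY _ (hX n) (hY n)

end CohomologyIn

/-! ### One-step resolutions of unbounded complexes -/

section Resolutions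

open CochainComplex HomComplex

variable {A : Type u} [Category.{v} A] [Abelian A]

lemma prop_mappingCone_X (W : ObjectProperty A) [W.IsClosedUnderIsomorphisms]
    [W.IsClosedUnderExtensions] {K L : CochainComplex A ℤ} (φ : K ⟶ L)
    (hK : ∀ n, W (K.X n)) (hL : ∀ n, W (L.X n)) (n : ℤ) : W ((mappingCone φ).X n) :=
  W.prop_of_iso (HomologicalComplex.homotopyCofiber.XIsoBiprod φ n (n + 1) rfl).symm
    (W.prop_biprod (hK _) (hL _))

/-- The complex with given terms and zero differentials. -/
def zeroComplex (G : ℤ → A) : CochainComplex A ℤ where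
  X := G
  d _ _ := 0

/-- Every complex receives a termwise epimorphism from a complex with terms in a class of objects
of which every object is a quotient. -/
lemma exists_epi_from (W : ObjectProperty A) [W.IsClosedUnderIsomorphisms]
    [W.IsClosedUnderExtensions] (hW : ∀ N : A, ∃ (P : A) (p : P ⟶ N), Epi p ∧ W P)
    (M : CochainComplex A ℤ) :
    ∃ (E : CochainComplex A ℤ) (p : E ⟶ M), Epi p ∧ ∀ n, W (E.X n) := by
  choose P p hp hP using fun n : ℤ => hW (M.X (n - 1))
  -- The cone of `𝟙 G` has `G.X (n + 1)` as a summand in degree `n`, so `P n` is chosen to cover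
  -- `M.X (n - 1)`. The degree `-1` cochain `α` is arbitrary; taking `β` to be its coboundary makes
  -- the pair a chain map.
  let G := zeroComplex P
  let p' (n : ℤ) : G.X n ⟶ M.X (n - 1) := p n
  have hp' (n : ℤ) : Epi (p' n) := hp n
  let α : Cochain G M (-1) := Cochain.mk fun i j hij =>
    p' i ≫ (M.XIsoOfEq (show i - 1 = j by lia)).hom
  let β : G ⟶ M := (Cocycle.mk (δ (-1) 0 α) 1 rfl (δ_δ _ _ _ _)).homOf
  refine ⟨mappingCone (𝟙 G), mappingCone.desc (𝟙 G) α β (by simp [β]), ?_,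
    prop_mappingCone_X W _ hP hP⟩
  have (n : ℤ) : Epi ((mappingCone.desc (𝟙 G) α β (by simp [β])).f n) := by
    have h : Epi ((mappingCone.inl (𝟙 G)).v (n + 1) n (by lia) ≫
        (mappingCone.desc (𝟙 G) α β (by simp [β])).f n) := by
      rw [mappingCone.inl_v_desc_f]
      dsimp only [α, Cochain.mk_v]
      infer_instance
    exact @epi_of_epi _ _ _ _ _ _ _ h
  exact HomologicalComplex.epi_of_epi_f _ this

/-- Every complex has a termwise monomorphism to a complex with terms in a class of objects
of which every object has an embedding. -/
lemma exists_mono_to (W : ObjectProperty A) [W.IsClosedUnderIsomorphisms]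
    [W.IsClosedUnderExtensions] (hW : ∀ N : A, ∃ (I : A) (i : N ⟶ I), Mono i ∧ W I)
    (M : CochainComplex A ℤ) :
    ∃ (E : CochainComplex A ℤ) (i : M ⟶ E), Mono i ∧ ∀ n, W (E.X n) := by
  choose I i hi hI using fun n : ℤ => hW (M.X n)
  -- Here it is the unshifted summand of the cone that detects injectivity, so no shift of index is
  -- needed.
  let G := zeroComplex I
  let i' (n : ℤ) : M.X n ⟶ G.X n := i n
  have hi' (n : ℤ) : Mono (i' n) := hi n
  let β : Cochain M G 0 := Cochain.ofHoms i'
  let α : Cocycle M G 1 := Cocycle.mk (-δ 0 1 β) 2 rfl (by simp [δ_δ])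
  refine ⟨mappingCone (𝟙 G), mappingCone.lift (𝟙 G) α β (by simp [α]), ?_,
    prop_mappingCone_X W _ hI hI⟩
  have (n : ℤ) : Mono ((mappingCone.lift (𝟙 G) α β (by simp [α])).f n) := by
    have h : Mono ((mappingCone.lift (𝟙 G) α β (by simp [α])).f n ≫
        (mappingCone.snd (𝟙 G)).v n n (add_zero n)) := by
      rw [mappingCone.lift_f_snd_v]
      dsimp only [β]
      rw [Cochain.ofHoms_v]
      infer_instance
    exact mono_of_mono _ ((mappingCone.snd (𝟙 G)).v n n (add_zero n))
  exact HomologicalComplex.mono_of_mono_f _ this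

/-- Left resolutions of unbounded complexes by objects in a class closed under subobjects and
extensions of which every object is a quotient. -/
lemma exists_left_resolution (W : ObjectProperty A) [W.IsClosedUnderIsomorphisms]
    [W.IsClosedUnderExtensions] (hsub : ∀ {M N : A} (i : M ⟶ N) [Mono i], W N → W M)
    (hW : ∀ N : A, ∃ (P : A) (p : P ⟶ N), Epi p ∧ W P) (M : CochainComplex A ℤ) :
    ∃ (P : CochainComplex A ℤ) (p : P ⟶ M), QuasiIso p ∧ ∀ n, W (P.X n) := by
  obtain ⟨E, p, _, hE⟩ := exists_epi_from W hW M
  have hS : (ShortComplex.mk (kernel.ι p) p (kernel.condition p)).ShortExact :=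
    { exact := ShortComplex.kernelSequence_exact p }
  -- Closure under subobjects puts the terms of `kernel p` in `W`, so the resolution stops after one
  -- step.
  exact ⟨_, mappingCone.descShortComplex (ShortComplex.mk (kernel.ι p) p (kernel.condition p)),
    mappingCone.quasiIso_descShortComplex hS,
    prop_mappingCone_X W _ (fun n => hsub ((kernel.ι p).f n) (hE n)) hE⟩

section

variable {S : ShortComplex (CochainComplex A ℤ)}

/-- For a short exact sequence of complexes, the canonical morphism from the shift of the first
complex to the mapping cone of the second morphism. -/
noncomputable def toMappingCone (S : ShortComplex (CochainComplex A ℤ)) :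
    S.X₁⟦(1 : ℤ)⟧ ⟶ mappingCone S.g where
  f n := S.f.f (n + 1) ≫ (mappingCone.inl S.g).v (n + 1) n (by lia)
  comm' i j hij := by
    obtain rfl : i + 1 = j := hij
    have h : S.f.f (i + 1) ≫ S.g.f (i + 1) = 0 := by
      rw [← HomologicalComplex.comp_f, S.zero, HomologicalComplex.zero_f]
    simp [mappingCone.inl_v_d S.g (i + 1) i (i + 1 + 1) (by lia) (by lia), reassoc_of% h]

lemma toMappingCone_map (S : ShortComplex (CochainComplex A ℤ)) :
    toMappingCone S ≫ mappingCone.map S.g (𝟙 S.X₃) S.g (𝟙 _) (by simp) = 0 := by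
  ext n
  have h : S.f.f (n + 1) ≫ S.g.f (n + 1) = 0 := by
    rw [← HomologicalComplex.comp_f, S.zero, HomologicalComplex.zero_f]
  refine mappingCone.ext_to _ n (n + 1) rfl ?_ ?_ <;>
    simp [toMappingCone, mappingCone.map, h] <;> exact zero_comp.symm

/-- In degree `n` the second map is `S.g` on the summand `S.X₂.X (n + 1)` and the identity on
`S.X₃.X n`, so its kernel is `S.X₁.X (n + 1)`. The quotient, the cone of an identity, is
contractible, which makes `toMappingCone S` invertible in the derived category. -/
lemma shortExact_toMappingCone (hS : S.ShortExact) :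
    (ShortComplex.mk _ _ (toMappingCone_map S)).ShortExact := by
  refine HomologicalComplex.shortExact_of_degreewise_shortExact _ fun n => ?_
  have hS' := hS.map_of_exact (HomologicalComplex.eval A (ComplexShape.up ℤ) (n + 1))
  have hf : Mono (S.f.f (n + 1)) := hS'.mono_f
  have hg : Epi (S.g.f (n + 1)) := hS'.epi_g
  have hfst : (toMappingCone S).f n ≫ (mappingCone.fst S.g).1.v n (n + 1) rfl =
      S.f.f (n + 1) := by
    simp [toMappingCone]
  have hsnd : (toMappingCone S).f n ≫ (mappingCone.snd S.g).v n n (add_zero n) = 0 := by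
    simp [toMappingCone]
    rfl
  have hmono : Mono ((toMappingCone S).f n) :=
    @mono_of_mono_fac _ _ _ _ _ _ _ _ hf hfst
  have hepi : Epi ((mappingCone.map S.g (𝟙 S.X₃) S.g (𝟙 _) (by simp)).f n) := by
    refine Preadditive.epi_of_cancel_zero _ fun k hk => ?_
    refine mappingCone.ext_from _ (n + 1) n rfl ?_ ?_
    · have h := (mappingCone.inl S.g).v (n + 1) n (by lia) ≫= hk
      simpa [mappingCone.map, ← cancel_epi (S.g.f (n + 1))] using h
    · simpa [mappingCone.map] using (mappingCone.inr S.g).f n ≫= hk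
  refine { mono_f := hmono, epi_g := hepi, exact := ShortComplex.exact_of_f_is_kernel _ ?_ }
  refine @KernelFork.IsLimit.ofι' _ _ _ _ _ _ _ ((toMappingCone S).f n) _ (hi := hmono)
    fun {T} k hk => ?_
  have hk' : k ≫ (mappingCone.map S.g (𝟙 S.X₃) S.g (𝟙 _) (by simp)).f n = 0 := hk
  have h₁ : k ≫ (mappingCone.fst S.g).1.v n (n + 1) rfl ≫ S.g.f (n + 1) = 0 := by
    have := hk' =≫ (mappingCone.fst (𝟙 S.X₃)).1.v n (n + 1) rfl
    simpa [mappingCone.map, mappingCone.desc_f _ _ _ _ n (n + 1) rfl] using this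
  have h₂ : k ≫ (mappingCone.snd S.g).v n n (add_zero n) = 0 := by
    have := hk' =≫ (mappingCone.snd (𝟙 S.X₃)).v n n (add_zero n)
    simpa [mappingCone.map, mappingCone.desc_f _ _ _ _ n (n + 1) rfl] using this
  have := hS'.mono_f
  have hl := ShortComplex.Exact.lift' hS'.exact
    (k ≫ (mappingCone.fst S.g).1.v n (n + 1) rfl) ((Category.assoc _ _ _).trans h₁)
  refine ⟨hl.choose, mappingCone.ext_to _ n (n + 1) rfl ?_ ?_⟩
  · exact (Category.assoc _ _ _).trans ((congrArg _ hfst).trans hl.choose_spec)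
  · exact (Category.assoc _ _ _).trans ((congrArg _ hsnd).trans (comp_zero.trans h₂.symm))

lemma isIso_Q_map_toMappingCone [HasDerivedCategory.{w} A] (hS : S.ShortExact) :
    IsIso (DerivedCategory.Q.map (toMappingCone S)) := by
  refine (Triangle.isZero₃_iff_isIso₁ _ (DerivedCategory.triangleOfSES_distinguished
    (shortExact_toMappingCone hS))).1 ?_
  have h := DerivedCategory.Q_map_eq_of_homotopy A (mappingCone.homotopyToZeroOfId S.X₃)
  rw [CategoryTheory.Functor.map_id, CategoryTheory.Functor.map_zero] at h
  exact (IsZero.iff_id_eq_zero _).2 h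

end

/-- Right resolutions of unbounded complexes by objects in a class closed under quotients and
extensions in which every object embeds. -/
lemma exists_right_resolution [HasDerivedCategory.{w} A] (W : ObjectProperty A)
    [W.IsClosedUnderIsomorphisms]
    [W.IsClosedUnderExtensions] (hquot : ∀ {M N : A} (p : M ⟶ N) [Epi p], W M → W N)
    (hW : ∀ N : A, ∃ (I : A) (i : N ⟶ I), Mono i ∧ W I) (M : CochainComplex A ℤ) :
    ∃ (I : CochainComplex A ℤ) (i : M ⟶ I), IsIso (DerivedCategory.Q.map i) ∧
      ∀ n, W (I.X n) := by
  -- The cone of the quotient map resolves the shift by `1` of the subcomplex, so the embedding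
  -- starts from `M⟦-1⟧`.
  obtain ⟨E, i, _, hE⟩ := exists_mono_to W hW (M⟦(-1 : ℤ)⟧)
  have hS : (ShortComplex.mk i (cokernel.π i) (cokernel.condition i)).ShortExact :=
    { exact := ShortComplex.cokernelSequence_exact i }
  have := isIso_Q_map_toMappingCone hS
  refine ⟨_, (shiftFunctorCompIsoId (CochainComplex A ℤ) (-1 : ℤ) 1 (by lia)).inv.app M ≫
    (toMappingCone (ShortComplex.mk i (cokernel.π i) (cokernel.condition i)) :), ?_,
    prop_mappingCone_X W _ hE (fun n => hquot ((cokernel.π i).f n) (hE n))⟩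
  rw [Functor.map_comp]
  infer_instance

end Resolutions

/-! ### Adjunctions applied termwise to complexes -/

section Adjunctions

variable {C D : Type*} [Category* C] [Category* D] [Preadditive C] [Preadditive D]
  {G : C ⥤ D} {F : D ⥤ C} [G.Additive] [F.Additive] (adj : G ⊣ F)
  {ι : Type*} {c : ComplexShape ι}

/-- The termwise unit of an adjunction on a complex. -/
@[simps]
def complexUnit (K : HomologicalComplex C c) :
    K ⟶ (F.mapHomologicalComplex c).obj ((G.mapHomologicalComplex c).obj K) where
  f n := adj.unit.app (K.X n)
  comm' i j _ := (adj.unit.naturality (K.d i j)).symm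

/-- The termwise counit of an adjunction on a complex. -/
@[simps]
def complexCounit (L : HomologicalComplex D c) :
    (G.mapHomologicalComplex c).obj ((F.mapHomologicalComplex c).obj L) ⟶ L where
  f n := adj.counit.app (L.X n)
  comm' i j _ := (adj.counit.naturality (L.d i j)).symm

lemma exists_complexUnit_comp_map {K : HomologicalComplex C c} {L : HomologicalComplex D c}
    (f : K ⟶ (F.mapHomologicalComplex c).obj L) :
    ∃ g : (G.mapHomologicalComplex c).obj K ⟶ L,
      complexUnit adj K ≫ (F.mapHomologicalComplex c).map g = f := by
  refine ⟨(G.mapHomologicalComplex c).map f ≫ complexCounit adj L, ?_⟩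
  ext n
  have h : ∀ {M : C} {N : D} (f : M ⟶ F.obj N),
      adj.unit.app M ≫ F.map (G.map f ≫ adj.counit.app N) = f := by simp
  exact h (f.f n)

lemma exists_map_comp_complexCounit {K : HomologicalComplex C c} {L : HomologicalComplex D c}
    (f : (G.mapHomologicalComplex c).obj K ⟶ L) :
    ∃ g : K ⟶ (F.mapHomologicalComplex c).obj L,
      (G.mapHomologicalComplex c).map g ≫ complexCounit adj L = f := by
  refine ⟨complexUnit adj K ≫ (F.mapHomologicalComplex c).map f, ?_⟩
  ext n
  have h : ∀ {M : C} {N : D} (f : G.obj M ⟶ N),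
      G.map (adj.unit.app M ≫ F.map f) ≫ adj.counit.app N = f := by simp
  exact h (f.f n)

end Adjunctions

/-! ### Derived functors of exact inclusions -/

section ExactInclusion

variable {A B : Type*} [Category* A] [Category* B] [Abelian A] [Abelian B]
  [HasDerivedCategory.{w} A] [HasDerivedCategory.{w'} B] (F : B ⥤ A) [F.Additive]
  [PreservesFiniteLimits F] [PreservesFiniteColimits F]

/-- An exact functor commutes with cohomology. -/
lemma nonempty_homology_mapDerivedCategory_iso (M : DerivedCategory B) (n : ℤ) :
    Nonempty ((DerivedCategory.homologyFunctor A n).obj (F.mapDerivedCategory.obj M) ≅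
      F.obj ((DerivedCategory.homologyFunctor B n).obj M)) := by
  obtain ⟨K, ⟨e⟩⟩ : ∃ K, Nonempty (DerivedCategory.Q.obj K ≅ M) :=
    ⟨_, ⟨DerivedCategory.Q.objObjPreimageIso M⟩⟩
  exact ⟨(DerivedCategory.homologyFunctor A n).mapIso (F.mapDerivedCategory.mapIso e.symm ≪≫
      F.mapDerivedCategoryFactors.app K) ≪≫
    (DerivedCategory.homologyFunctorFactors A n).app _ ≪≫ (K.sc n).mapHomologyIso F ≪≫
    F.mapIso (((DerivedCategory.homologyFunctorFactors B n).app K).symm ≪≫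
      (DerivedCategory.homologyFunctor B n).mapIso e)⟩

lemma mapDerivedCategory_map_Q_map {K L : CochainComplex B ℤ} (f : K ⟶ L) :
    F.mapDerivedCategory.map (DerivedCategory.Q.map f) = F.mapDerivedCategoryFactors.hom.app K ≫
      DerivedCategory.Q.map ((F.mapHomologicalComplex (ComplexShape.up ℤ)).map f) ≫
        F.mapDerivedCategoryFactors.inv.app L :=
  (NatIso.naturality_2 F.mapDerivedCategoryFactors f).symm

/-- To lift morphisms along the functor induced by an exact functor on derived categories, it is
enough to consider complexes. -/
lemma full_mapDerivedCategory
    (h : ∀ (K L : CochainComplex B ℤ)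
      (f : DerivedCategory.Q.obj ((F.mapHomologicalComplex (ComplexShape.up ℤ)).obj K) ⟶
        DerivedCategory.Q.obj ((F.mapHomologicalComplex (ComplexShape.up ℤ)).obj L)),
      ∃ g : DerivedCategory.Q.obj K ⟶ DerivedCategory.Q.obj L,
        F.mapDerivedCategory.map g = F.mapDerivedCategoryFactors.hom.app K ≫ f ≫
          F.mapDerivedCategoryFactors.inv.app L) :
    F.mapDerivedCategory.Full where
  map_surjective {M N} f := by
    let e₁ := DerivedCategory.Q.objObjPreimageIso M
    let e₂ := DerivedCategory.Q.objObjPreimageIso N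
    obtain ⟨g, hg⟩ := h _ _ (F.mapDerivedCategoryFactors.inv.app _ ≫
      F.mapDerivedCategory.map e₁.hom ≫ f ≫ F.mapDerivedCategory.map e₂.inv ≫
      F.mapDerivedCategoryFactors.hom.app _)
    refine ⟨e₁.inv ≫ g ≫ e₂.hom, ?_⟩
    rw [Functor.map_comp, Functor.map_comp, hg]
    simp [← Functor.map_comp, ← Functor.map_comp_assoc]

variable [F.Faithful]

lemma isZero_of_isZero_mapDerivedCategory_obj {M : DerivedCategory B}
    (hM : IsZero (F.mapDerivedCategory.obj M)) : IsZero M := by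
  refine isZero_of_homology fun n => ?_
  obtain ⟨e⟩ := nonempty_homology_mapDerivedCategory_iso F M n
  have h : IsZero (F.obj ((DerivedCategory.homologyFunctor B n).obj M)) :=
    (Functor.map_isZero _ hM).of_iso e.symm
  rw [IsZero.iff_id_eq_zero] at h ⊢
  exact F.map_injective (by simpa using h)

instance : F.mapDerivedCategory.ReflectsIsomorphisms where
  reflects {M N} f hf := by
    obtain ⟨Z, g, h, hT⟩ := distinguished_cocone_triangle f
    refine (Triangle.isZero₃_iff_isIso₁ _ hT).1
      (isZero_of_isZero_mapDerivedCategory_obj F ?_)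
    exact (Triangle.isZero₃_iff_isIso₁ _ (F.mapDerivedCategory.map_distinguished _ hT)).2 hf

/-- If the image of `f` is zero, then the image of the map `g` to the cone of `f` is a split mono.
Fullness lifts the retraction to some `r`, conservativity makes `g ≫ r` invertible, and `f ≫ g = 0`
forces `f = 0`. -/
lemma faithful_mapDerivedCategory [F.mapDerivedCategory.Full] : F.mapDerivedCategory.Faithful := by
  have key : ∀ {M N : DerivedCategory B} (f : M ⟶ N), F.mapDerivedCategory.map f = 0 → f = 0 := by
    intro M N f hf
    obtain ⟨Z, g, h, hT⟩ := distinguished_cocone_triangle f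
    obtain ⟨r, hr⟩ : ∃ r : F.mapDerivedCategory.obj Z ⟶ F.mapDerivedCategory.obj N,
        𝟙 (F.mapDerivedCategory.obj N) = F.mapDerivedCategory.map g ≫ r :=
      Triangle.yoneda_exact₂ _ (F.mapDerivedCategory.map_distinguished _ hT) (𝟙 _)
        ((Category.comp_id _).trans hf)
    obtain ⟨r, rfl⟩ := F.mapDerivedCategory.map_surjective r
    have hr' : F.mapDerivedCategory.map (g ≫ r) = 𝟙 _ := by
      rw [Functor.map_comp]
      exact hr.symm
    have : IsIso (F.mapDerivedCategory.map (g ≫ r)) := by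
      rw [hr']
      infer_instance
    have := isIso_of_reflects_iso (g ≫ r) F.mapDerivedCategory
    rw [← cancel_mono (g ≫ r), zero_comp, ← Category.assoc]
    have h₀ : f ≫ g = 0 := comp_distTriang_mor_zero₁₂ _ hT
    rw [h₀, zero_comp]
  constructor
  intro M N f f' hff'
  rw [← sub_eq_zero]
  apply key
  rw [Functor.map_sub, hff', sub_self]

end ExactInclusion

/-! ### Full faithfulness on derived categories -/

section

variable {A : Type u} [Category.{v} A] [Abelian A]

lemma prop_kernel_of_arrow_iso (P : ObjectProperty A) [P.IsClosedUnderIsomorphisms]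
    {M N M' N' : A} {f : M ⟶ N} {g : M' ⟶ N'} (e : Arrow.mk f ≅ Arrow.mk g)
    (h : P (kernel g)) : P (kernel f) :=
  P.prop_of_iso (kernel.mapIso f g (Arrow.leftFunc.mapIso e) (Arrow.rightFunc.mapIso e)
    (Arrow.w e.hom).symm).symm h

lemma prop_cokernel_of_arrow_iso (P : ObjectProperty A) [P.IsClosedUnderIsomorphisms]
    {M N M' N' : A} {f : M ⟶ N} {g : M' ⟶ N'} (e : Arrow.mk f ≅ Arrow.mk g)
    (h : P (cokernel g)) : P (cokernel f) :=
  P.prop_of_iso (cokernel.mapIso f g (Arrow.leftFunc.mapIso e) (Arrow.rightFunc.mapIso e)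
    (Arrow.w e.hom).symm).symm h

variable [HasExt.{w'} A] {X Y : ObjectProperty A}

lemma exists_leftAdjoint_of_kernelAcyclic [IsAbelianSubcategory X] (hXY : ExtOrthogonal X Y)
    (hE : ∀ M : A, Nonempty (FiveTermSequence X Y M)) :
    ∃ (G : A ⥤ Y.FullSubcategory) (adj : G ⊣ Y.ι), ∀ M : A, kernelAcyclic X M →
      X (kernel (adj.unit.app M)) ∧ X (cokernel (adj.unit.app M)) := by
  obtain ⟨G, adj, h⟩ := exists_leftAdjoint hXY hE
  refine ⟨G, adj, fun M hM => ?_⟩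
  obtain ⟨E, ⟨e⟩⟩ := h M
  exact ⟨prop_kernel_of_arrow_iso X e (E.prop_kernel_c hM),
    prop_cokernel_of_arrow_iso X e (X.prop_of_iso E.cokernelIso.symm E.prop_X₂)⟩

lemma exists_rightAdjoint_of_cokernelAcyclic [IsAbelianSubcategory Y] (hXY : ExtOrthogonal X Y)
    (hE : ∀ M : A, Nonempty (FiveTermSequence X Y M)) :
    ∃ (F : A ⥤ X.FullSubcategory) (adj : X.ι ⊣ F), ∀ M : A, cokernelAcyclic Y M →
      Y (kernel (adj.counit.app M)) ∧ Y (cokernel (adj.counit.app M)) := by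
  obtain ⟨F, adj, h⟩ := exists_rightAdjoint hXY hE
  refine ⟨F, adj, fun M hM => ?_⟩
  obtain ⟨E, ⟨e⟩⟩ := h M
  exact ⟨prop_kernel_of_arrow_iso Y e (Y.prop_of_iso E.kernelIso.symm E.prop_Y₁),
    prop_cokernel_of_arrow_iso Y e (E.prop_cokernel_b hM)⟩

end

section

variable {A : Type u} [Category.{v} A] [Abelian A] [HasDerivedCategory.{w} A]

lemma cohomologyIn_mapDerivedCategory_obj (P : ObjectProperty A) [IsAbelianSubcategory P]
    [HasDerivedCategory.{w'} P.FullSubcategory] (M : DerivedCategory P.FullSubcategory) :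
    cohomologyIn P (P.ι.mapDerivedCategory.obj M) := fun n => by
  obtain ⟨e⟩ := nonempty_homology_mapDerivedCategory_iso P.ι M n
  exact P.prop_of_iso e.symm ((DerivedCategory.homologyFunctor _ n).obj M).property

variable {X Y : ObjectProperty A} [IsAbelianSubcategory X]

section

variable {G : A ⥤ Y.FullSubcategory} [G.Additive] (adj : G ⊣ Y.ι)
  (hG : ∀ M : A, kernelAcyclic X M → X (kernel (adj.unit.app M)) ∧ X (cokernel (adj.unit.app M)))
include hG

lemma trW_Q_map_complexUnit [X.IsClosedUnderExtensions] {K : CochainComplex A ℤ}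
    (hK : ∀ n, kernelAcyclic X (K.X n)) :
    (cohomologyIn X).trW (DerivedCategory.Q.map (complexUnit adj K)) :=
  trW_Q_map X _ (fun n => (hG _ (hK n)).1) (fun n => (hG _ (hK n)).2)

variable [X.IsClosedUnderExtensions] [IsAbelianSubcategory Y] [Y.IsClosedUnderExtensions]
  (hXY : ∀ M, X M → Y M → IsZero M)
include hXY

lemma isIso_Q_map_complexUnit {K : CochainComplex A ℤ}
    (hK : ∀ n, kernelAcyclic X (K.X n)) (hY : cohomologyIn Y (DerivedCategory.Q.obj K)) :
    IsIso (DerivedCategory.Q.map (complexUnit adj K)) :=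
  isIso_of_trW hXY _ (trW_Q_map_complexUnit adj hG hK) hY
    (cohomologyIn_Q_obj Y fun _ => (G.obj _).property)

variable (hP : ∀ M : A, ∃ (P : A) (p : P ⟶ M), Epi p ∧ kernelAcyclic X P)
  [HasDerivedCategory.{w'} Y.FullSubcategory]
include hP

/-- After an acyclic resolution `P`, the unit from `P` to its termwise reflection is a
quasi-isomorphism, and the reflection is a complex over `Y`. -/
lemma exists_iso_mapDerivedCategory_right {M : DerivedCategory A} (hM : cohomologyIn Y M) :
    ∃ L, Nonempty (Y.ι.mapDerivedCategory.obj L ≅ M) := by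
  obtain ⟨K, ⟨e⟩⟩ : ∃ K, Nonempty (DerivedCategory.Q.obj K ≅ M) :=
    ⟨_, ⟨DerivedCategory.Q.objObjPreimageIso M⟩⟩
  obtain ⟨P, p, _, hP⟩ := exists_left_resolution (kernelAcyclic X)
    (fun i _ => kernelAcyclic_of_mono X i) hP K
  have := isIso_Q_map_complexUnit adj hG hXY hP
    ((cohomologyIn Y).prop_of_iso (asIso (DerivedCategory.Q.map p) ≪≫ e).symm hM)
  exact ⟨DerivedCategory.Q.obj ((G.mapHomologicalComplex _).obj P),
    ⟨Y.ι.mapDerivedCategoryFactors.app _ ≪≫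
      (asIso (DerivedCategory.Q.map (complexUnit adj P))).symm ≪≫
      asIso (DerivedCategory.Q.map p) ≪≫ e⟩⟩

lemma full_mapDerivedCategory_right : Y.ι.mapDerivedCategory.Full := by
  refine full_mapDerivedCategory _ fun K L f => ?_
  obtain ⟨M, s, hs, g, rfl⟩ := DerivedCategory.right_fac f
  obtain ⟨P, p, _, hP⟩ := exists_left_resolution (kernelAcyclic X)
    (fun i _ => kernelAcyclic_of_mono X i) hP M
  have := isIso_Q_map_complexUnit adj hG hXY hP
    ((cohomologyIn Y).prop_of_iso (asIso (DerivedCategory.Q.map p) ≪≫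
      asIso (DerivedCategory.Q.map s)).symm (cohomologyIn_Q_obj Y fun _ => (K.X _).property))
  -- Both legs of the roof end in complexes over `Y`, so they factor through the termwise reflection
  -- of `P`, giving an equivalent roof inside `Y`.
  obtain ⟨s', hs'⟩ := exists_complexUnit_comp_map adj (p ≫ s)
  obtain ⟨g', hg'⟩ := exists_complexUnit_comp_map adj (p ≫ g)
  have hs'' : DerivedCategory.Q.map (complexUnit adj P) ≫ DerivedCategory.Q.map
      ((Y.ι.mapHomologicalComplex _).map s') = DerivedCategory.Q.map p ≫
        DerivedCategory.Q.map s := by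
    rw [← Functor.map_comp, ← Functor.map_comp, hs']
  have hg'' : DerivedCategory.Q.map (complexUnit adj P) ≫ DerivedCategory.Q.map
      ((Y.ι.mapHomologicalComplex _).map g') = DerivedCategory.Q.map p ≫
        DerivedCategory.Q.map g := by
    rw [← Functor.map_comp, ← Functor.map_comp, hg']
  have h₁ : IsIso (DerivedCategory.Q.map ((Y.ι.mapHomologicalComplex _).map s')) :=
    IsIso.of_isIso_fac_left hs''
  have h₂ : IsIso (DerivedCategory.Q.map s') := by
    rw [DerivedCategory.isIso_Q_map_iff_quasiIso] at h₁ ⊢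
    exact (HomologicalComplex.quasiIso_map_iff_of_preservesHomology s' Y.ι).1 h₁
  refine ⟨inv (DerivedCategory.Q.map s') ≫ DerivedCategory.Q.map g', ?_⟩
  have h₃ : inv (DerivedCategory.Q.map s) ≫ DerivedCategory.Q.map g =
      inv (DerivedCategory.Q.map ((Y.ι.mapHomologicalComplex _).map s')) ≫
        DerivedCategory.Q.map ((Y.ι.mapHomologicalComplex _).map g') := by
    rw [IsIso.eq_inv_comp, ← cancel_epi (DerivedCategory.Q.map (complexUnit adj P)),
      hg'', ← Category.assoc, hs'']
    simp
  rw [h₃, Functor.map_comp, Functor.map_inv, IsIso.inv_comp_eq, mapDerivedCategory_map_Q_map,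
    mapDerivedCategory_map_Q_map]
  simp

end

section

variable {X Y : ObjectProperty A} [IsAbelianSubcategory Y]
  {F : A ⥤ X.FullSubcategory} [F.Additive] (adj : X.ι ⊣ F)
  (hF : ∀ M : A, cokernelAcyclic Y M →
    Y (kernel (adj.counit.app M)) ∧ Y (cokernel (adj.counit.app M)))
  [Y.IsClosedUnderExtensions]
include hF

lemma trW_Q_map_complexCounit {K : CochainComplex A ℤ}
    (hK : ∀ n, cokernelAcyclic Y (K.X n)) :
    (cohomologyIn Y).trW (DerivedCategory.Q.map (complexCounit adj K)) :=
  trW_Q_map Y _ (fun n => (hF _ (hK n)).1) (fun n => (hF _ (hK n)).2)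

variable [IsAbelianSubcategory X] [X.IsClosedUnderExtensions] (hXY : ∀ M, X M → Y M → IsZero M)
include hXY

lemma isIso_Q_map_complexCounit {K : CochainComplex A ℤ}
    (hK : ∀ n, cokernelAcyclic Y (K.X n)) (hX : cohomologyIn X (DerivedCategory.Q.obj K)) :
    IsIso (DerivedCategory.Q.map (complexCounit adj K)) :=
  isIso_of_trW (fun M hY hX => hXY M hX hY) _ (trW_Q_map_complexCounit adj hF hK)
    (cohomologyIn_Q_obj X fun _ => (F.obj _).property) hX

variable (hI : ∀ M : A, ∃ (I : A) (i : M ⟶ I), Mono i ∧ cokernelAcyclic Y I)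
  [HasDerivedCategory.{w'} X.FullSubcategory]
include hI

lemma full_mapDerivedCategory_left : X.ι.mapDerivedCategory.Full := by
  refine full_mapDerivedCategory _ fun K L f => ?_
  obtain ⟨M, g, s, hs, rfl⟩ := DerivedCategory.left_fac f
  obtain ⟨I, i, _, hI⟩ := exists_right_resolution (cokernelAcyclic Y)
    (fun p _ => cokernelAcyclic_of_epi Y p) hI M
  have := isIso_Q_map_complexCounit adj hF hXY hI
    ((cohomologyIn X).prop_of_iso (asIso (DerivedCategory.Q.map s) ≪≫
      asIso (DerivedCategory.Q.map i)) (cohomologyIn_Q_obj X fun _ => (L.X _).property))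
  -- Dually, both legs of the coroof start in complexes over `X` and factor through the termwise
  -- coreflection of `I`.
  obtain ⟨s', hs'⟩ := exists_map_comp_complexCounit adj (s ≫ i)
  obtain ⟨g', hg'⟩ := exists_map_comp_complexCounit adj (g ≫ i)
  have hs'' : DerivedCategory.Q.map ((X.ι.mapHomologicalComplex _).map s') ≫
      DerivedCategory.Q.map (complexCounit adj I) = DerivedCategory.Q.map s ≫
        DerivedCategory.Q.map i := by
    rw [← Functor.map_comp, ← Functor.map_comp, hs']
  have hg'' : DerivedCategory.Q.map ((X.ι.mapHomologicalComplex _).map g') ≫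
      DerivedCategory.Q.map (complexCounit adj I) = DerivedCategory.Q.map g ≫
        DerivedCategory.Q.map i := by
    rw [← Functor.map_comp, ← Functor.map_comp, hg']
  have h₁ : IsIso (DerivedCategory.Q.map ((X.ι.mapHomologicalComplex _).map s')) :=
    IsIso.of_isIso_fac_right hs''
  have h₂ : IsIso (DerivedCategory.Q.map s') := by
    rw [DerivedCategory.isIso_Q_map_iff_quasiIso] at h₁ ⊢
    exact (HomologicalComplex.quasiIso_map_iff_of_preservesHomology s' X.ι).1 h₁
  refine ⟨DerivedCategory.Q.map g' ≫ inv (DerivedCategory.Q.map s'), ?_⟩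
  have h₃ : DerivedCategory.Q.map g ≫ inv (DerivedCategory.Q.map s) =
      DerivedCategory.Q.map ((X.ι.mapHomologicalComplex _).map g') ≫
        inv (DerivedCategory.Q.map ((X.ι.mapHomologicalComplex _).map s')) := by
    rw [IsIso.comp_inv_eq, ← cancel_mono (DerivedCategory.Q.map i), ← hg'', Category.assoc,
      Category.assoc, ← hs'']
    simp
  rw [h₃, Functor.map_comp, Functor.map_inv, IsIso.comp_inv_eq, mapDerivedCategory_map_Q_map,
    mapDerivedCategory_map_Q_map]
  simp

end

end

/-! ### Boundedness and approximation triangles -/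

/-- The third object of a distinguished triangle may be replaced by an isomorphic object. -/
lemma distinguished_of_iso₃ {C : Type*} [Category* C] [HasZeroObject C] [HasShift C ℤ]
    [Preadditive C] [∀ n : ℤ, (shiftFunctor C n).Additive] [Pretriangulated C]
    {M₁ M₂ M₃ N : C} {f : M₁ ⟶ M₂} {g : M₂ ⟶ M₃} {h : M₃ ⟶ M₁⟦(1 : ℤ)⟧}
    (hT : Triangle.mk f g h ∈ distTriang C) (e : N ≅ M₃) :
    Triangle.mk f (g ≫ e.inv) (e.hom ≫ h) ∈ distTriang C :=
  isomorphic_distinguished _ hT _ (Triangle.isoMk _ _ (Iso.refl _) (Iso.refl _) e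
    ((Category.comp_id f).trans (Category.id_comp f).symm)
    ((Category.assoc _ _ _).trans (((congrArg (g ≫ ·) e.inv_hom_id).trans
      (Category.comp_id g)).trans (Category.id_comp g).symm))
    ((congrArg ((e.hom ≫ h) ≫ ·) (CategoryTheory.Functor.map_id _ M₁)).trans
      (Category.comp_id _)))

section

variable {A : Type u} [Category.{v} A] [Abelian A] [HasDerivedCategory.{w} A]

section

variable (P : ObjectProperty A) [IsAbelianSubcategory P]
  [HasDerivedCategory.{w'} P.FullSubcategory]

lemma isZero_homology_of_mapDerivedCategory {M : DerivedCategory P.FullSubcategory} {n : ℤ}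
    (h : IsZero ((DerivedCategory.homologyFunctor A n).obj (P.ι.mapDerivedCategory.obj M))) :
    IsZero ((DerivedCategory.homologyFunctor _ n).obj M) := by
  obtain ⟨e⟩ := nonempty_homology_mapDerivedCategory_iso P.ι M n
  have hzero := h.of_iso e.symm
  rw [IsZero.iff_id_eq_zero] at hzero ⊢
  exact P.ι.map_injective (by simpa using hzero)

/-- The functor `D(P) ⥤ D(A)` reflects boundedness. -/
lemma Boundedness.prop_of_map (s : Boundedness) {M : DerivedCategory P.FullSubcategory}
    (hM : s.prop A (P.ι.mapDerivedCategory.obj M)) : s.prop _ M := by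
  have hplus : ∀ n : ℤ, (P.ι.mapDerivedCategory.obj M).IsGE n → M.IsGE n := fun n hn =>
    (DerivedCategory.isGE_iff _ _).2 fun i hi => isZero_homology_of_mapDerivedCategory P
      ((DerivedCategory.isGE_iff _ _).1 hn i hi)
  have hminus : ∀ n : ℤ, (P.ι.mapDerivedCategory.obj M).IsLE n → M.IsLE n := fun n hn =>
    (DerivedCategory.isLE_iff _ _).2 fun i hi => isZero_homology_of_mapDerivedCategory P
      ((DerivedCategory.isLE_iff _ _).1 hn i hi)
  cases s with
  | bounded => exact ⟨hM.1.imp hplus, hM.2.imp hminus⟩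
  | below => exact hM.imp hplus
  | above => exact hM.imp hminus
  | unbounded => trivial

lemma full_derivedInclusion (s : Boundedness) [P.ι.mapDerivedCategory.Full] :
    (derivedInclusion P s).Full := by
  dsimp only [derivedInclusion]
  infer_instance

lemma faithful_derivedInclusion (s : Boundedness) [P.ι.mapDerivedCategory.Faithful] :
    (derivedInclusion P s).Faithful := by
  dsimp only [derivedInclusion]
  infer_instance

end

section

variable {X Y : ObjectProperty A} (hXY : ∀ M, X M → Y M → IsZero M)
  [X.IsClosedUnderIsomorphisms] {T : Triangle (DerivedCategory A)} (hT : T ∈ distTriang _)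
  (h₁ : cohomologyIn X T.obj₁) (h₃ : cohomologyIn Y T.obj₃)
include hXY hT h₁ h₃

/-- In a triangle with outer terms having cohomology in two classes of objects with trivial
intersection, the cohomology of the outer terms vanishes where that of the middle term does. -/
lemma isZero_homology_of_distTriang {n m : ℤ} (hnm : n + 1 = m)
    (hn : IsZero ((DerivedCategory.homologyFunctor A n).obj T.obj₂))
    (hm : IsZero ((DerivedCategory.homologyFunctor A m).obj T.obj₂)) :
    IsZero ((DerivedCategory.homologyFunctor A n).obj T.obj₃) ∧
      IsZero ((DerivedCategory.homologyFunctor A m).obj T.obj₁) := by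
  have := (DerivedCategory.HomologySequence.exact₃ T hT n m hnm).mono_g (hn.eq_of_src _ _)
  have := (DerivedCategory.HomologySequence.exact₁ T hT n m hnm).epi_f (hm.eq_of_tgt _ _)
  have : IsIso (DerivedCategory.HomologySequence.δ T n m hnm) := isIso_of_mono_of_epi _
  let e := asIso (DerivedCategory.HomologySequence.δ T n m hnm)
  have h := hXY _ (X.prop_of_iso e.symm (h₁ m)) (h₃ n)
  exact ⟨h, h.of_iso e.symm⟩

lemma Boundedness.prop_obj₁ (s : Boundedness) (h₂ : s.prop A T.obj₂) : s.prop A T.obj₁ := by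
  have key {n m : ℤ} := isZero_homology_of_distTriang hXY hT h₁ h₃ (n := n) (m := m)
  have hplus : ∀ n : ℤ, T.obj₂.IsGE n → T.obj₁.IsGE n := fun n hn => by
    rw [DerivedCategory.isGE_iff] at hn ⊢
    exact fun i hi => (key (n := i - 1) (by lia) (hn _ (by lia)) (hn _ hi)).2
  have hminus : ∀ n : ℤ, T.obj₂.IsLE n → T.obj₁.IsLE (n + 1) := fun n hn => by
    rw [DerivedCategory.isLE_iff] at hn ⊢
    exact fun i hi => (key (n := i - 1) (by lia) (hn _ (by lia)) (hn _ (by lia))).2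
  cases s with
  | bounded => exact ⟨h₂.1.imp hplus, h₂.2.elim fun n hn => ⟨n + 1, hminus n hn⟩⟩
  | below => exact h₂.imp hplus
  | above => exact h₂.elim fun n hn => ⟨n + 1, hminus n hn⟩
  | unbounded => trivial

end

variable {X Y : ObjectProperty A} [IsAbelianSubcategory X] [IsAbelianSubcategory Y]
  {F : A ⥤ X.FullSubcategory} [F.Additive] (adj : X.ι ⊣ F)
  (hF : ∀ M : A, cokernelAcyclic Y M →
    Y (kernel (adj.counit.app M)) ∧ Y (cokernel (adj.counit.app M)))
  [Y.IsClosedUnderExtensions]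
  (hI : ∀ M : A, ∃ (I : A) (i : M ⟶ I), Mono i ∧ cokernelAcyclic Y I)
  [HasDerivedCategory.{w'} X.FullSubcategory]

include hF hI in
/-- Every object of the derived category can be approximated by an object from `D(X)`. -/
lemma exists_trW_from_left (M : DerivedCategory A) :
    ∃ (K : DerivedCategory X.FullSubcategory) (f : X.ι.mapDerivedCategory.obj K ⟶ M),
      (cohomologyIn Y).trW f := by
  obtain ⟨K, ⟨e⟩⟩ : ∃ K, Nonempty (DerivedCategory.Q.obj K ≅ M) :=
    ⟨_, ⟨DerivedCategory.Q.objObjPreimageIso M⟩⟩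
  obtain ⟨I, i, _, hI⟩ := exists_right_resolution (cokernelAcyclic Y)
    (fun p _ => cokernelAcyclic_of_epi Y p) hI K
  refine ⟨DerivedCategory.Q.obj ((F.mapHomologicalComplex _).obj I),
    (X.ι.mapDerivedCategoryFactors.app _).hom ≫
      DerivedCategory.Q.map (complexCounit adj I) ≫
      ((asIso (DerivedCategory.Q.map i)).symm ≪≫ e).hom, ?_⟩
  exact (MorphismProperty.cancel_left_of_respectsIso (cohomologyIn Y).trW _ _).2
    ((MorphismProperty.cancel_right_of_respectsIso (cohomologyIn Y).trW _ _).2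
      (trW_Q_map_complexCounit adj hF hI))

include hF hI in
/-- The approximation triangles in `D*(A)`. -/
lemma exists_distTriang_dstar (hXY : ∀ M, X M → Y M → IsZero M)
    [HasDerivedCategory.{w'} Y.FullSubcategory]
    (hY : ∀ M : DerivedCategory A, cohomologyIn Y M →
      ∃ L, Nonempty (Y.ι.mapDerivedCategory.obj L ≅ M)) (s : Boundedness) (M : DStar A s) :
    ∃ (K : _) (L : _) (f : (derivedInclusion X s).obj K ⟶ M)
      (g : M ⟶ (derivedInclusion Y s).obj L)
      (h : (derivedInclusion Y s).obj L ⟶ ((derivedInclusion X s).obj K)⟦(1 : ℤ)⟧),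
      Triangle.mk f g h ∈ distTriang (DStar A s) := by
  obtain ⟨K, f, hf⟩ := exists_trW_from_left adj hF hI M.obj
  have hK : s.prop _ K := by
    obtain ⟨C, g, h, hT⟩ := distinguished_cocone_triangle f
    exact s.prop_of_map X (s.prop_obj₁ hXY hT (cohomologyIn_mapDerivedCategory_obj X K)
      (((cohomologyIn Y).trW_iff_of_distinguished _ hT).1 hf) M.property)
  let K' : DStar X.FullSubcategory s := ⟨K, hK⟩
  let f' : (derivedInclusion X s).obj K' ⟶ M := ObjectProperty.homMk f
  obtain ⟨C, g, h, hT⟩ := distinguished_cocone_triangle f'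
  obtain ⟨L, ⟨e⟩⟩ := hY C.obj (((cohomologyIn Y).trW_iff_of_distinguished _
    ((s.prop A).ι.map_distinguished _ hT)).1 hf)
  let L' : DStar Y.FullSubcategory s :=
    ⟨L, s.prop_of_map Y ((s.prop A).prop_of_iso e.symm C.property)⟩
  let e' : (derivedInclusion Y s).obj L' ≅ C := (s.prop A).fullyFaithfulι.preimageIso e
  exact ⟨K', L', f', g ≫ e'.inv, e'.hom ≫ h, distinguished_of_iso₃ hT e'⟩

end

section

open DerivedCategory

variable {A : Type u} [Category.{v} A] [Abelian A] [HasDerivedCategory.{w} A]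

lemma hom_single_shift_eq_zero_of_neg {M N : A} {n : ℤ} (hn : n < 0)
    (f : (singleFunctor A 0).obj M ⟶ ((singleFunctor A 0).obj N)⟦n⟧) : f = 0 := by
  have := TStructure.t.isGE_shift ((singleFunctor A 0).obj N) 0 n (-n) (by simp)
  exact TStructure.t.zero f 0 (-n) (by lia)

lemma dstar_single_hom_eq_zero_iff (s : Boundedness) (M N : A) (n : ℤ) :
    (∀ f : (DStar.single A s).obj M ⟶ ((DStar.single A s).obj N)⟦n⟧, f = 0) ↔
      ∀ f : (singleFunctor A 0).obj M ⟶ ((singleFunctor A 0).obj N)⟦n⟧, f = 0 := by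
  let e : ((DStar.single A s).obj M ⟶ ((DStar.single A s).obj N)⟦n⟧) ≃+
      ((singleFunctor A 0).obj M ⟶ ((singleFunctor A 0).obj N)⟦n⟧) :=
    { toEquiv := (s.prop A).fullyFaithfulι.homEquiv.trans
        (((s.prop A).ι.commShiftIso n).app _).homToEquiv
      map_add' := fun f g => (congrArg (· ≫ _) ((s.prop A).ι.map_add)).trans
        (Preadditive.add_comp _ _ _ _ _ _) }
  refine ⟨fun h f => ?_, fun h f => ?_⟩
  · rw [← e.apply_symm_apply f, h (e.symm f), map_zero]
  · rw [← e.symm_apply_apply f, h (e f), map_zero]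

lemma extOrthogonal_iff [HasExt.{w'} A] (X Y : ObjectProperty A) :
    ExtOrthogonal X Y ↔ ∀ (M N : A), X M → Y N → ∀ (n : ℤ)
      (f : (singleFunctor A 0).obj M ⟶ ((singleFunctor A 0).obj N)⟦n⟧), f = 0 := by
  refine ⟨fun h M N hM hN n f => ?_, fun h n M N hM hN e => ?_⟩
  · obtain hn | hn := lt_or_ge n 0
    · exact hom_single_shift_eq_zero_of_neg hn f
    · obtain ⟨n, rfl⟩ := Int.eq_ofNat_of_zero_le hn
      obtain ⟨e, rfl⟩ := Abelian.Ext.homEquiv.surjective f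
      rw [h n M N hM hN e]
      exact Abelian.Ext.zero_hom M N n
  · apply Abelian.Ext.homEquiv.injective
    exact (h M N hM hN n _).trans (Abelian.Ext.zero_hom M N n).symm

/-- The first part of the theorem: orthogonality, approximations, and enough acyclic objects on
both sides give a decomposition of the derived category. -/
theorem isDStarDecomposition_of_extOrthogonal [HasExt.{w'} A] {X Y : ObjectProperty A}
    [X.IsClosedUnderIsomorphisms] [Y.IsClosedUnderIsomorphisms] (s : Boundedness)
    (hXY : ExtOrthogonal X Y) (hE : ∀ M : A, Nonempty (FiveTermSequence X Y M))
    (hI : ∀ M : A, ∃ (I : A) (i : M ⟶ I) (E : FiveTermSequence X Y I), Mono i ∧ IsZero E.X₂)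
    (hP : ∀ M : A, ∃ (P : A) (p : P ⟶ M) (E : FiveTermSequence X Y P), Epi p ∧ IsZero E.Y₁) :
    IsDStarDecomposition s X Y := by
  have := isAbelianSubcategory_left hXY hE
  have := isAbelianSubcategory_right hXY hE
  have := isClosedUnderExtensions_left hXY hE
  have := isClosedUnderExtensions_right hXY hE
  let := HasDerivedCategory.standard X.FullSubcategory
  let := HasDerivedCategory.standard Y.FullSubcategory
  obtain ⟨G, adjG, hG⟩ := exists_leftAdjoint_of_kernelAcyclic hXY hE
  obtain ⟨F, adjF, hF⟩ := exists_rightAdjoint_of_cokernelAcyclic hXY hE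
  have := adjG.left_adjoint_additive
  have := adjF.right_adjoint_additive
  have hXY' : ∀ M, X M → Y M → IsZero M := fun M hX hY => hXY.isZero hX hY
  have hP' : ∀ M : A, ∃ (P : A) (p : P ⟶ M), Epi p ∧ kernelAcyclic X P := fun M => by
    obtain ⟨P, p, E, hp, hE⟩ := hP M
    exact ⟨P, p, hp, E.kernelAcyclic_of_isZero hXY hE⟩
  have hI' : ∀ M : A, ∃ (I : A) (i : M ⟶ I), Mono i ∧ cokernelAcyclic Y I := fun M => by
    obtain ⟨I, i, E, hi, hE⟩ := hI M
    exact ⟨I, i, hi, E.cokernelAcyclic_of_isZero hXY hE⟩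
  have := full_mapDerivedCategory_left adjF hF hXY' hI'
  have := full_mapDerivedCategory_right adjG hG hXY' hP'
  have := faithful_mapDerivedCategory X.ι
  have := faithful_mapDerivedCategory Y.ι
  exact
    { abelian_left := inferInstance
      abelian_right := inferInstance
      fullyFaithful_left := ⟨full_derivedInclusion X s, faithful_derivedInclusion X s⟩
      fullyFaithful_right := ⟨full_derivedInclusion Y s, faithful_derivedInclusion Y s⟩
      orthogonal := fun M N hM hN n => (dstar_single_hom_eq_zero_iff s M N n).2
        ((extOrthogonal_iff X Y).1 hXY M N hM hN n)
      exists_triangle := exists_distTriang_dstar adjF hF hI' hXY'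
        (fun _ => exists_iso_mapDerivedCategory_right adjG hG hXY' hP') s }

end

section

open HomologicalComplex DerivedCategory

variable {B : Type u} [Category.{v} B] [Abelian B]

/-- A quasi-isomorphism to a complex concentrated in a single degree is an epimorphism in this
degree. -/
lemma epi_f_of_quasiIso_to_single {K : CochainComplex B ℤ} {k : ℤ} {M : B}
    (s : K ⟶ (single B (ComplexShape.up ℤ) k).obj M) [QuasiIso s] : Epi (s.f k) := by
  have h := homologyπ_naturality s k
  have : Epi (homologyMap s k) := inferInstance
  have h' : Epi (cyclesMap s k ≫ homologyπ _ k) := by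
    rw [← h]
    infer_instance
  have := isIso_homologyπ ((single B (ComplexShape.up ℤ) k).obj M) (k - 1) k (by simp) (by simp)
  have := isIso_iCycles ((single B (ComplexShape.up ℤ) k).obj M) k (k + 1) (by simp) (by simp)
  have : Epi (cyclesMap s k) := (MorphismProperty.cancel_right_of_respectsIso
    (MorphismProperty.epimorphisms B) (cyclesMap s k) (homologyπ _ k)).1 h'
  have : Epi (iCycles K k ≫ s.f k) := by
    rw [← cyclesMap_i]
    infer_instance
  exact epi_of_epi (iCycles K k) (s.f k)

/-- A quasi-isomorphism from a complex concentrated in a single degree is a monomorphism in this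
degree. -/
lemma mono_f_of_quasiIso_from_single {K : CochainComplex B ℤ} {k : ℤ} {M : B}
    (s : (single B (ComplexShape.up ℤ) k).obj M ⟶ K) [QuasiIso s] : Mono (s.f k) := by
  have h := homologyι_naturality s k
  have : Mono (homologyMap s k) := inferInstance
  have h' : Mono (homologyι _ k ≫ opcyclesMap s k) := by
    rw [← h]
    infer_instance
  have := isIso_homologyι ((single B (ComplexShape.up ℤ) k).obj M) k (k + 1) (by simp) (by simp)
  have := isIso_pOpcycles ((single B (ComplexShape.up ℤ) k).obj M) (k - 1) k (by simp) (by simp)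
  have : Mono (opcyclesMap s k) := (MorphismProperty.cancel_left_of_respectsIso
    (MorphismProperty.monomorphisms B) (homologyι _ k) (opcyclesMap s k)).1 h'
  have : Mono (s.f k ≫ pOpcycles K k) := by
    rw [← p_opcyclesMap]
    infer_instance
  exact mono_of_mono (s.f k) (pOpcycles K k)

variable [HasDerivedCategory.{w} B]

/-- A morphism from a stalk complex to a complex with cohomology in lower degrees is killed by an
epimorphism. -/
lemma exists_epi_comp_eq_zero_of_isLE {M : B} {k : ℤ} {L : DerivedCategory B} [L.IsLE (k - 1)]
    (f : (singleFunctor B k).obj M ⟶ L) :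
    ∃ (M' : B) (p : M' ⟶ M), Epi p ∧ (singleFunctor B k).map p ≫ f = 0 := by
  obtain ⟨L', _, ⟨e⟩⟩ := L.exists_iso_Q_obj_of_isLE (k - 1)
  have : CochainComplex.IsStrictlyLE ((single B (ComplexShape.up ℤ) k).obj M) k :=
    inferInstanceAs (CochainComplex.IsStrictlyLE ((CochainComplex.singleFunctor B k).obj M) k)
  obtain ⟨K, _, s, hs, g, hg⟩ := right_fac_of_isStrictlyLE
    (X := (single B (ComplexShape.up ℤ) k).obj M) (f ≫ e.hom) k
  have : QuasiIso s := (isIso_Q_map_iff_quasiIso B s).1 hs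
  have := epi_f_of_quasiIso_to_single s
  let j : (single B (ComplexShape.up ℤ) k).obj (K.X k) ⟶ K :=
    mkHomFromSingle (𝟙 _) (fun i hi =>
      (K.isZero_of_isStrictlyLE k i (by simp at hi; lia)).eq_of_tgt _ _)
  let p : K.X k ⟶ M := s.f k ≫ (singleObjXSelf (ComplexShape.up ℤ) k M).hom
  have h₁ : j ≫ s = (single B (ComplexShape.up ℤ) k).map p := by
    apply from_single_hom_ext
    simp [j, p, single_map_f_self]
  have h₂ : j ≫ g = 0 := by
    apply from_single_hom_ext
    exact (L'.isZero_of_isStrictlyLE (k - 1) k (by lia)).eq_of_tgt _ _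
  refine ⟨K.X k, p, epi_comp _ _, ?_⟩
  rw [← cancel_mono e.hom, zero_comp, Category.assoc]
  change Q.map ((single B (ComplexShape.up ℤ) k).map p) ≫ f ≫ e.hom = 0
  rw [hg, ← h₁, Q.map_comp, Category.assoc, IsIso.hom_inv_id_assoc, ← Q.map_comp, h₂, Q.map_zero]

/-- A morphism to a stalk complex from a complex with cohomology in higher degrees is killed by a
monomorphism. -/
lemma exists_mono_comp_eq_zero_of_isGE {M : B} {k : ℤ} {L : DerivedCategory B} [L.IsGE (k + 1)]
    (f : L ⟶ (singleFunctor B k).obj M) :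
    ∃ (M' : B) (i : M ⟶ M'), Mono i ∧ f ≫ (singleFunctor B k).map i = 0 := by
  obtain ⟨L', _, ⟨e⟩⟩ := L.exists_iso_Q_obj_of_isGE (k + 1)
  have : CochainComplex.IsStrictlyGE ((single B (ComplexShape.up ℤ) k).obj M) k :=
    inferInstanceAs (CochainComplex.IsStrictlyGE ((CochainComplex.singleFunctor B k).obj M) k)
  obtain ⟨K, _, g, s, hs, hg⟩ := left_fac_of_isStrictlyGE
    (Y := (single B (ComplexShape.up ℤ) k).obj M) (e.inv ≫ f) k
  have : QuasiIso s := (isIso_Q_map_iff_quasiIso B s).1 hs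
  have := mono_f_of_quasiIso_from_single s
  let j : K ⟶ (single B (ComplexShape.up ℤ) k).obj (K.X k) :=
    mkHomToSingle (𝟙 _) (fun i hi =>
      (K.isZero_of_isStrictlyGE k i (by simp at hi; lia)).eq_of_src _ _)
  let p : M ⟶ K.X k := (singleObjXSelf (ComplexShape.up ℤ) k M).inv ≫ s.f k
  have h₁ : s ≫ j = (single B (ComplexShape.up ℤ) k).map p := by
    apply to_single_hom_ext
    simp [j, p, single_map_f_self]
  have h₂ : g ≫ j = 0 := by
    apply to_single_hom_ext
    exact (L'.isZero_of_isStrictlyGE (k + 1) k (by lia)).eq_of_src _ _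
  refine ⟨K.X k, p, mono_comp _ _, ?_⟩
  rw [← cancel_epi e.inv, comp_zero, ← Category.assoc]
  refine (congrArg (· ≫ Q.map ((single B (ComplexShape.up ℤ) k).map p)) hg).trans ?_
  rw [← h₁, Q.map_comp, Category.assoc, IsIso.inv_hom_id_assoc, ← Q.map_comp, h₂, Q.map_zero]
  rfl

variable {M N : B} {n : ℤ} (hn : 0 < n)
  (f : (singleFunctor B 0).obj M ⟶ ((singleFunctor B 0).obj N)⟦n⟧)
include hn

lemma exists_epi_comp_eq_zero :
    ∃ (M' : B) (p : M' ⟶ M), Epi p ∧ (singleFunctor B 0).map p ≫ f = 0 := by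
  have := TStructure.t.isLE_shift ((singleFunctor B 0).obj N) 0 n (-n) (by simp)
  have : (((singleFunctor B 0).obj N)⟦n⟧).IsLE (0 - 1) :=
    TStructure.t.isLE_of_le _ (-n) (0 - 1) (by lia)
  exact exists_epi_comp_eq_zero_of_isLE f

lemma exists_mono_comp_eq_zero :
    ∃ (N' : B) (i : N ⟶ N'), Mono i ∧ f ≫ ((singleFunctor B 0).map i)⟦n⟧' = 0 := by
  have : ((singleFunctor B 0).obj M).IsGE (-n + 1) :=
    TStructure.t.isGE_of_ge _ (-n + 1) 0 (by lia)
  let e := (singleFunctors B).shiftIso n (-n) 0 (by simp)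
  obtain ⟨N', i, hi, h⟩ := exists_mono_comp_eq_zero_of_isGE (k := -n) (f ≫ e.hom.app N)
  refine ⟨N', i, hi, ?_⟩
  rw [← cancel_mono (e.hom.app N'), zero_comp, ← h, Category.assoc, Category.assoc]
  exact congrArg (f ≫ ·) (e.hom.naturality i)

end

section

open DerivedCategory

variable {A : Type u} [Category.{v} A] [Abelian A] [HasDerivedCategory.{w} A]
  (P : ObjectProperty A) [IsAbelianSubcategory P] [HasDerivedCategory.{w'} P.FullSubcategory]

lemma map_derivedInclusion_surjective (s : Boundedness) [(derivedInclusion P s).Full]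
    {K L : DerivedCategory P.FullSubcategory} (hK : s.prop _ K) (hL : s.prop _ L) :
    Function.Surjective (P.ι.mapDerivedCategory.map : (K ⟶ L) → _) := fun f => by
  let K' : DStar P.FullSubcategory s := ⟨K, hK⟩
  let L' : DStar P.FullSubcategory s := ⟨L, hL⟩
  obtain ⟨g, hg⟩ := (derivedInclusion P s).map_surjective (X := K') (Y := L')
    (ObjectProperty.homMk f)
  exact ⟨(s.prop _).ι.map g, congrArg (s.prop A).ι.map hg⟩

variable (s : Boundedness) [(derivedInclusion P s).Full] {n : ℤ} (M N : P.FullSubcategory)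
  (ξ : (singleFunctor A 0).obj M.obj ⟶ ((singleFunctor A 0).obj N.obj)⟦n⟧)

/-- The comparison between shifted stalk complexes over an abelian subcategory and over the
ambient category. -/
noncomputable def mapDerivedCategorySingleShiftIso (n : ℤ) :
    (singleFunctor P.FullSubcategory 0 ⋙ shiftFunctor _ n) ⋙ P.ι.mapDerivedCategory ≅
      P.ι ⋙ singleFunctor A 0 ⋙ shiftFunctor _ n :=
  Functor.associator _ _ _ ≪≫
    Functor.isoWhiskerLeft _ (P.ι.mapDerivedCategory.commShiftIso n) ≪≫
    (Functor.associator _ _ _).symm ≪≫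
    Functor.isoWhiskerRight (P.ι.mapDerivedCategorySingleFunctor 0) _ ≪≫ Functor.associator _ _ _

include s in
lemma exists_map_comp_singleShiftIso_eq :
    ∃ g : (singleFunctor P.FullSubcategory 0).obj M ⟶
        ((singleFunctor P.FullSubcategory 0).obj N)⟦n⟧,
      P.ι.mapDerivedCategory.map g ≫ (mapDerivedCategorySingleShiftIso P n).hom.app N =
        (P.ι.mapDerivedCategorySingleFunctor 0).hom.app M ≫ ξ := by
  obtain ⟨g, hg⟩ := map_derivedInclusion_surjective P s (s.prop_single _ M)
    ((s.prop _).le_shift n _ (s.prop_single _ N))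
    ((P.ι.mapDerivedCategorySingleFunctor 0).hom.app M ≫ ξ ≫
      (mapDerivedCategorySingleShiftIso P n).inv.app N)
  refine ⟨g, ?_⟩
  rw [hg, Category.assoc, Category.assoc]
  erw [Iso.inv_hom_id_app, Category.comp_id]

variable (hn : 0 < n)
include s hn

lemma exists_epi_comp_eq_zero_of_full :
    ∃ (M' : P.FullSubcategory) (p : M' ⟶ M), Epi (P.ι.map p) ∧
      (singleFunctor A 0).map (P.ι.map p) ≫ ξ = 0 := by
  obtain ⟨g, hg⟩ := exists_map_comp_singleShiftIso_eq P s M N ξ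
  obtain ⟨M', p, hp, h⟩ := exists_epi_comp_eq_zero hn g
  refine ⟨M', p, inferInstance, ?_⟩
  have h₁ := (P.ι.mapDerivedCategorySingleFunctor 0).hom.naturality p
  rw [← cancel_epi ((P.ι.mapDerivedCategorySingleFunctor 0).hom.app M'), comp_zero]
  refine (Category.assoc _ _ _).symm.trans ((congrArg (· ≫ ξ) h₁.symm).trans ?_)
  refine (Category.assoc _ _ _).trans ((congrArg (_ ≫ ·) hg.symm).trans ?_)
  refine (Category.assoc _ _ _).symm.trans ?_
  refine (congrArg (· ≫ _) ((P.ι.mapDerivedCategory.map_comp _ _).symm.trans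
    ((congrArg _ h).trans (P.ι.mapDerivedCategory.map_zero _ _)))).trans zero_comp

lemma exists_mono_comp_eq_zero_of_full :
    ∃ (N' : P.FullSubcategory) (i : N ⟶ N'), Mono (P.ι.map i) ∧
      ξ ≫ ((singleFunctor A 0).map (P.ι.map i))⟦n⟧' = 0 := by
  obtain ⟨g, hg⟩ := exists_map_comp_singleShiftIso_eq P s M N ξ
  obtain ⟨N', i, hi, h⟩ := exists_mono_comp_eq_zero hn g
  refine ⟨N', i, inferInstance, ?_⟩
  have h₁ := (mapDerivedCategorySingleShiftIso P n).hom.naturality i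
  rw [← cancel_epi ((P.ι.mapDerivedCategorySingleFunctor 0).hom.app M), comp_zero]
  refine (Category.assoc _ _ _).symm.trans ((congrArg (· ≫ _) hg.symm).trans ?_)
  refine (Category.assoc _ _ _).trans ((congrArg (_ ≫ ·) h₁.symm).trans ?_)
  refine (Category.assoc _ _ _).symm.trans ?_
  refine (congrArg (· ≫ _) ((P.ι.mapDerivedCategory.map_comp _ _).symm.trans
    ((congrArg _ h).trans (P.ι.mapDerivedCategory.map_zero _ _)))).trans zero_comp

end

section

open Abelian

variable {A : Type u} [Category.{v} A] [Abelian A] [HasDerivedCategory.{w} A] [HasExt.{w'} A]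
  (P : ObjectProperty A) [IsAbelianSubcategory P] (s : Boundedness)
  {M N : A} (hM : P M) (hN : P N) {n : ℕ} (ξ : Ext M N (n + 1))
include hM hN s

/-- If `D*(P)` is a full subcategory of `D*(A)`, then the extensions in `A` of objects of `P` are
killed by epimorphisms in `P`. -/
lemma exists_epi_mk₀_comp_eq_zero (h : (standardDerivedInclusion P s).Full) :
    ∃ (M' : A) (p : M' ⟶ M), P M' ∧ Epi p ∧ (Ext.mk₀ p).comp ξ (zero_add _) = 0 := by
  let := HasDerivedCategory.standard P.FullSubcategory
  have : (derivedInclusion P s).Full := h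
  obtain ⟨M', p, hp, h⟩ := exists_epi_comp_eq_zero_of_full P s ⟨M, hM⟩ ⟨N, hN⟩ ξ.hom (by lia)
  refine ⟨M'.obj, P.ι.map p, M'.property, hp, Ext.ext ?_⟩
  rw [Ext.comp_hom, Ext.mk₀_hom, ShiftedHom.mk₀_comp, Ext.zero_hom]
  exact h

/-- If `D*(P)` is a full subcategory of `D*(A)`, then the extensions in `A` of objects of `P` are
killed by monomorphisms in `P`. -/
lemma exists_mono_comp_mk₀_eq_zero (h : (standardDerivedInclusion P s).Full) :
    ∃ (N' : A) (i : N ⟶ N'), P N' ∧ Mono i ∧ ξ.comp (Ext.mk₀ i) (add_zero _) = 0 := by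
  let := HasDerivedCategory.standard P.FullSubcategory
  have : (derivedInclusion P s).Full := h
  obtain ⟨N', i, hi, h⟩ := exists_mono_comp_eq_zero_of_full P s ⟨M, hM⟩ ⟨N, hN⟩ ξ.hom (by lia)
  refine ⟨N'.obj, P.ι.map i, N'.property, hi, Ext.ext ?_⟩
  rw [Ext.comp_hom, Ext.mk₀_hom, ShiftedHom.comp_mk₀, Ext.zero_hom]
  exact h

end

section

open DerivedCategory

variable {A : Type u} [Category.{v} A] [Abelian A]

/-- Five-term sequences may be transported along isomorphisms. -/
def FiveTermSequence.ofIso {X Y : ObjectProperty A} {M N : A} (E : FiveTermSequence X Y M)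
    (e : M ≅ N) : FiveTermSequence X Y N where
  Y₁ := E.Y₁
  X₁ := E.X₁
  Y₂ := E.Y₂
  X₂ := E.X₂
  prop_Y₁ := E.prop_Y₁
  prop_X₁ := E.prop_X₁
  prop_Y₂ := E.prop_Y₂
  prop_X₂ := E.prop_X₂
  a := E.a
  b := E.b ≫ e.hom
  c := e.inv ≫ E.c
  d := E.d
  mono_a := E.mono_a
  w₁ := by rw [← Category.assoc, E.w₁, zero_comp]
  exact₁ := ShortComplex.exact_of_iso (ShortComplex.isoMk (S₁ := ShortComplex.mk _ _ E.w₁)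
    (Iso.refl _) (Iso.refl _) e
    (by simp) (by simp)) E.exact₁
  w₂ := by simp [E.w₂]
  exact₂ := ShortComplex.exact_of_iso (ShortComplex.isoMk (S₁ := ShortComplex.mk _ _ E.w₂)
    (Iso.refl _) e (Iso.refl _)
    (by simp) (by simp)) E.exact₂
  w₃ := by rw [Category.assoc, E.w₃, comp_zero]
  exact₃ := ShortComplex.exact_of_iso (ShortComplex.isoMk (S₁ := ShortComplex.mk _ _ E.w₃)
    e (Iso.refl _) (Iso.refl _)
    (by simp) (by simp)) E.exact₃
  epi_d := E.epi_d

variable [HasDerivedCategory.{w} A]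

/-- The cohomology sequence of a triangle with stalk middle term is a five-term sequence. -/
lemma nonempty_fiveTermSequence_of_distTriang {X Y : ObjectProperty A} {M : A}
    {T : Triangle (DerivedCategory A)} (hT : T ∈ distTriang _) (h₁ : cohomologyIn X T.obj₁)
    (h₃ : cohomologyIn Y T.obj₃) (e : T.obj₂ ≅ (singleFunctor A 0).obj M) :
    Nonempty (FiveTermSequence X Y M) := by
  have hz : ∀ n : ℤ, n ≠ 0 → IsZero ((homologyFunctor A n).obj T.obj₂) := fun n hn => by
    refine IsZero.of_iso ?_ ((homologyFunctor A n).mapIso e)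
    obtain hn | hn := lt_or_gt_of_ne hn
    · exact isZero_of_isGE _ 0 n hn
    · exact isZero_of_isLE _ 0 n hn
  let E : FiveTermSequence X Y ((homologyFunctor A 0).obj T.obj₂) :=
    { Y₁ := (homologyFunctor A (-1)).obj T.obj₃
      X₁ := (homologyFunctor A 0).obj T.obj₁
      Y₂ := (homologyFunctor A 0).obj T.obj₃
      X₂ := (homologyFunctor A 1).obj T.obj₁
      prop_Y₁ := h₃ _
      prop_X₁ := h₁ _
      prop_Y₂ := h₃ _
      prop_X₂ := h₁ _
      a := HomologySequence.δ T (-1) 0 (by simp)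
      b := (homologyFunctor A 0).map T.mor₁
      c := (homologyFunctor A 0).map T.mor₂
      d := HomologySequence.δ T 0 1 (by simp)
      mono_a := (HomologySequence.exact₃ T hT (-1) 0 (by simp)).mono_g
        ((hz (-1) (by simp)).eq_of_src _ _)
      w₁ := HomologySequence.δ_comp T hT (-1) 0 (by simp)
      exact₁ := HomologySequence.exact₁ T hT (-1) 0 (by simp)
      w₂ := by
        rw [← Functor.map_comp, comp_distTriang_mor_zero₁₂ _ hT, Functor.map_zero]
      exact₂ := HomologySequence.exact₂ T hT 0
      w₃ := HomologySequence.comp_δ T hT 0 1 (by simp)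
      exact₃ := HomologySequence.exact₃ T hT 0 1 (by simp)
      epi_d := (HomologySequence.exact₁ T hT 0 1 (by simp)).epi_f
        ((hz 1 (by simp)).eq_of_tgt _ _) }
  exact ⟨E.ofIso ((homologyFunctor A 0).mapIso e ≪≫
    (singleFunctorCompHomologyFunctorIso A 0).app M)⟩

end

namespace FiveTermSequence

open Abelian

variable {A : Type u} [Category.{v} A] [Abelian A] [HasExt.{w'} A] {X Y : ObjectProperty A}
  (hXY : ExtOrthogonal X Y) {M : A} (E : FiveTermSequence X Y M)
include hXY

lemma isZero_X₂_of_injective [Injective M]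
    (h : ∀ ξ : Ext E.X₂ E.X₁ 2, ∃ (N : A) (p : N ⟶ E.X₂), X N ∧ Epi p ∧
      (Ext.mk₀ p).comp ξ (zero_add _) = 0) : IsZero E.X₂ := by
  have h₁ := E.shortExact_kernel_d
  have h₂ := E.shortExact_middle
  have h₃ := E.shortExact_cokernel_a
  obtain ⟨ξ, hξ⟩ := Ext.covariant_sequence_exact₃ _ h₃
    (h₁.extClass.comp h₂.extClass (show 1 + 1 = 2 by rfl)) (show 2 + 1 = 3 by rfl)
    (hXY _ _ _ E.prop_X₂ E.prop_Y₁ _)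
  obtain ⟨N, p, hN, _, hp⟩ := h ξ
  have hp' : ((Ext.mk₀ p).comp h₁.extClass (zero_add 1)).comp h₂.extClass
      (show 1 + 1 = 2 by rfl) = 0 := by
    rw [Ext.comp_assoc _ _ _ _ (show 1 + 1 = 2 by rfl) (by rfl), ← hξ,
      ← Ext.comp_assoc_of_third_deg_zero, hp, Ext.zero_comp]
  obtain ⟨x, hx⟩ := Ext.covariant_sequence_exact₃ _ h₂ _ _ hp'
  have hx' : (Ext.mk₀ p).comp h₁.extClass (zero_add 1) = 0 := by
    rw [← hx, Ext.eq_zero_of_injective x, Ext.zero_comp]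
  obtain ⟨y, hy⟩ := Ext.covariant_sequence_exact₃ _ h₁ _ _ hx'
  rw [hXY 0 _ _ hN E.prop_Y₂ y, Ext.zero_comp] at hy
  have hp₀ : p = 0 := (Ext.mk₀_eq_zero_iff p).1 hy.symm
  rw [IsZero.iff_id_eq_zero, ← cancel_epi p, hp₀, zero_comp, zero_comp]

lemma isZero_Y₁_of_projective [Projective M]
    (h : ∀ ξ : Ext E.Y₂ E.Y₁ 2, ∃ (N : A) (i : E.Y₁ ⟶ N), Y N ∧ Mono i ∧
      ξ.comp (Ext.mk₀ i) (add_zero _) = 0) : IsZero E.Y₁ := by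
  have h₁ := E.shortExact_kernel_d
  have h₂ := E.shortExact_middle
  have h₃ := E.shortExact_cokernel_a
  obtain ⟨ξ, hξ⟩ := Ext.contravariant_sequence_exact₁ h₁ _
    (h₂.extClass.comp h₃.extClass (show 1 + 1 = 2 by rfl)) (show 1 + 2 = 3 by rfl)
    (hXY _ _ _ E.prop_X₂ E.prop_Y₁ _)
  obtain ⟨N, i, hN, _, hi⟩ := h ξ
  have hi' : h₂.extClass.comp (h₃.extClass.comp (Ext.mk₀ i) (add_zero 1))
      (show 1 + 1 = 2 by rfl) = 0 := by
    rw [← Ext.comp_assoc _ _ _ (show 1 + 1 = 2 by rfl) _ (by rfl), ← hξ,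
      Ext.comp_assoc_of_third_deg_zero, hi, Ext.comp_zero]
  obtain ⟨x, hx⟩ := Ext.contravariant_sequence_exact₁ h₂ _ _ _ hi'
  have hx' : h₃.extClass.comp (Ext.mk₀ i) (add_zero 1) = 0 := by
    rw [← hx, Ext.eq_zero_of_projective x, Ext.comp_zero]
  obtain ⟨y, hy⟩ := Ext.contravariant_sequence_exact₁ h₃ _ _ _ hx'
  rw [hXY 0 _ _ E.prop_X₁ hN y, Ext.comp_zero] at hy
  have hi₀ : i = 0 := (Ext.mk₀_eq_zero_iff i).1 hy.symm
  rw [IsZero.iff_id_eq_zero, ← cancel_mono i, hi₀, comp_zero, comp_zero]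

end FiveTermSequence

namespace IsDStarDecomposition

variable {A : Type u} [Category.{v} A] [Abelian A] [HasDerivedCategory.{w} A]
  {s : Boundedness} {X Y : ObjectProperty A} (h : IsDStarDecomposition s X Y)
include h

lemma extOrthogonal [HasExt.{w'} A] : ExtOrthogonal X Y :=
  (extOrthogonal_iff X Y).2 fun M N hM hN n =>
    (dstar_single_hom_eq_zero_iff s M N n).1 (h.orthogonal M N hM hN n)

lemma nonempty_fiveTermSequence (M : A) : Nonempty (FiveTermSequence X Y M) := by
  have := h.abelian_left
  have := h.abelian_right
  let := HasDerivedCategory.standard X.FullSubcategory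
  let := HasDerivedCategory.standard Y.FullSubcategory
  obtain ⟨K, L, f, g, k, hT⟩ := h.exists_triangle ((DStar.single A s).obj M)
  exact nonempty_fiveTermSequence_of_distTriang ((s.prop A).ι.map_distinguished _ hT)
    (cohomologyIn_mapDerivedCategory_obj X K.obj) (cohomologyIn_mapDerivedCategory_obj Y L.obj)
    (Iso.refl _)

variable [HasExt.{w'} A] {M : A} (E : FiveTermSequence X Y M)

lemma isZero_X₂_of_injective [Injective M] : IsZero E.X₂ := by
  have := h.abelian_left
  exact E.isZero_X₂_of_injective h.extOrthogonal fun ξ =>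
    exists_epi_mk₀_comp_eq_zero X s E.prop_X₂ E.prop_X₁ ξ h.fullyFaithful_left.1

lemma isZero_Y₁_of_projective [Projective M] : IsZero E.Y₁ := by
  have := h.abelian_right
  exact E.isZero_Y₁_of_projective h.extOrthogonal fun ξ =>
    exists_mono_comp_mk₀_eq_zero Y s E.prop_Y₂ E.prop_Y₁ ξ h.fullyFaithful_right.1

end IsDStarDecomposition

end DerivedDecomposition

theorem theorem1p2 {A : Type u} [Category.{v} A] [Abelian A] [HasDerivedCategory.{w} A]
    [HasExt.{w'} A] (X Y : ObjectProperty A) [X.IsClosedUnderIsomorphisms]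
    [Y.IsClosedUnderIsomorphisms] (s : DerivedDecomposition.Boundedness) :
    -- (1)
    (DerivedDecomposition.ExtOrthogonal X Y →
      (∀ M : A, Nonempty (DerivedDecomposition.FiveTermSequence X Y M)) →
      (∀ M : A, ∃ (I : A) (i : M ⟶ I) (E : DerivedDecomposition.FiveTermSequence X Y I),
        Mono i ∧ IsZero E.X₂) →
      (∀ M : A, ∃ (P : A) (p : P ⟶ M) (E : DerivedDecomposition.FiveTermSequence X Y P),
        Epi p ∧ IsZero E.Y₁) →
      DerivedDecomposition.IsDStarDecomposition s X Y) ∧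
    -- (2)
    (EnoughProjectives A → EnoughInjectives A →
      (DerivedDecomposition.IsDStarDecomposition s X Y ↔
        DerivedDecomposition.ExtOrthogonal X Y ∧
        (∀ M : A, Nonempty (DerivedDecomposition.FiveTermSequence X Y M)) ∧
        (∀ M : A, Injective M →
          ∀ E : DerivedDecomposition.FiveTermSequence X Y M, IsZero E.X₂) ∧
        (∀ M : A, Projective M →
          ∀ E : DerivedDecomposition.FiveTermSequence X Y M, IsZero E.Y₁))) := by

  refine ⟨fun hXY hE hI hP =>
    DerivedDecomposition.isDStarDecomposition_of_extOrthogonal s hXY hE hI hP,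
    fun _ _ => ⟨fun h => ⟨h.extOrthogonal, h.nonempty_fiveTermSequence,
      fun _ _ E => h.isZero_X₂_of_injective E, fun _ _ E => h.isZero_Y₁_of_projective E⟩, ?_⟩⟩
  rintro ⟨hXY, hE, hI, hP⟩
  refine DerivedDecomposition.isDStarDecomposition_of_extOrthogonal s hXY hE
    (fun M => ⟨Injective.under M, Injective.ι M, (hE _).some, inferInstance, ?_⟩)
    (fun M => ⟨Projective.over M, Projective.π M, (hE _).some, inferInstance, ?_⟩)
  · exact hI _ inferInstance _
  · exact hP _ inferInstance _
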